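/- Let $J_0,J_1$ be the Bessel functions of the first kind of orders $0$ and $1$. Let $\lambda_{D,N,0}=\ell^2$, where $\ell$ (Lamb's constant) is the first positive zero of $x\mapsto J_0(x)-2xJ_1(x)$, and let $\lambda_{F,0}=j^2$, where $j$ is the first positive zero of $J_0$ (both zeros exist). All functions are complex-valued. Let $H^1((0,\pi))$ be the usual Sobolev space, $H^1_0((0,\pi))$ the closure of $C_0^\infty((0,\pi))$ in $H^1((0,\pi))$, let $$\mathcal D_{D,N}=\Big\{f\in H^1((0,\pi))\;\Big|\; f\in AC_{loc}((0,\pi)),\ f'(\pi)=0,\ f'-\frac{f}{2x}\in L^2((0,\pi);dx)\Big\},$$ where $f'(\pi)$ is the left derivative at $\pi$ (of $f$ extended to $\pi$ by its left limit), and let $d(x)=x$ for $0<x\le \pi/2$, $d(x)=\pi-x$ for $\pi/2\le x<\pi$. Then all integrals below are finite and $$\int_0^\pi |f'(x)|^2\,dx \ \ge\ \frac14\int_0^\pi \frac{|f(x)|^2}{x^2}\,dx+\frac{\lambda_{D,N,0}}{\pi^2}\int_0^\pi |f(x)|^2\,dx,\qquad f\in\mathcal D_{D,N},\tag{1}$$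 $$\int_0^\pi |f'(x)|^2\,dx \ \ge\ \frac14\int_0^\pi \frac{|f(x)|^2}{x^2}\,dx+\frac{\lambda_{F,0}}{\pi^2}\int_0^\pi |f(x)|^2\,dx,\qquad f\in H^1_0((0,\pi)),\tag{2}$$ $$\int_0^\pi |f'(x)|^2\,dx \ \ge\ \frac14\int_0^\pi \frac{|f(x)|^2}{d(x)^2}\,dx+\frac{4\lambda_{D,N,0}}{\pi^2}\int_0^\pi |f(x)|^2\,dx,\qquad f\in H^1_0((0,\pi)).\tag{3}$$ Each inequality is strict unless $f=0$ almost everywhere. All constants are optimal on the respective class of functions: if $\frac14$ is replaced by any larger number, the inequality fails for some $f$ in the class, even when the constant in front of $\int_0^\pi|f|^2\,dx$ is replaced by an arbitrary real number; and with $\frac14$ kept, the inequality fails for some $f$ in the class if the constant in front of $\int_0^\pi|f|^2\,dx$ is replaced by any larger number. -/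

import Mathlib

open MeasureTheory Set
open scoped ContDiff ENNReal

/-- The Bessel function of the first kind `J_n` of integer order `n ≥ 0`, on the real line,
given by its (everywhere convergent) power series. -/
noncomputable def besselJ (n : ℕ) (x : ℝ) : ℝ :=
  ∑' k : ℕ, (-1 : ℝ) ^ k / ((k.factorial : ℝ) * ((k + n).factorial : ℝ)) * (x / 2) ^ (2 * k + n)

/-- The positive zeros of `x ↦ J₀(x) - 2 x J₁(x)`. -/
def lambZeros : Set ℝ := {x | 0 < x ∧ besselJ 0 x - 2 * x * besselJ 1 x = 0}

/-- The positive zeros of `J₀`. -/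
def besselJ0Zeros : Set ℝ := {x | 0 < x ∧ besselJ 0 x = 0}

/-- Lamb's constant, the first positive zero of `J₀(x) - 2 x J₁(x)`. -/
noncomputable def lambConstant : ℝ := sInf lambZeros

/-- `λ_{D,N,0}`, the square of Lamb's constant. -/
noncomputable def lambdaDN : ℝ := lambConstant ^ 2

/-- `λ_{F,0}`, the square of the first positive zero of `J₀`. -/
noncomputable def lambdaF : ℝ := (sInf besselJ0Zeros) ^ 2

/-- `C₀^∞(Ω)`: smooth complex-valued functions with compact support contained in `Ω`. -/
def testFunctions (Ω : Set ℝ) : Set (ℝ → ℂ) :=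
  {φ | ContDiff ℝ ∞ φ ∧ HasCompactSupport φ ∧ tsupport φ ⊆ Ω}

/-- `g` is a weak (distributional) derivative of `f` on `Ω`. -/
def HasWeakDeriv (Ω : Set ℝ) (f g : ℝ → ℂ) : Prop :=
  LocallyIntegrableOn f Ω ∧ LocallyIntegrableOn g Ω ∧
    ∀ φ ∈ testFunctions Ω, ∫ x in Ω, deriv φ x * f x = -∫ x in Ω, φ x * g x

/-- The Sobolev space `H¹(Ω)`: functions in `L²(Ω)` with a weak derivative in `L²(Ω)`. -/
def sobolevH1 (Ω : Set ℝ) : Set (ℝ → ℂ) :=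
  {f | MemLp f 2 (volume.restrict Ω) ∧
    ∃ g, HasWeakDeriv Ω f g ∧ MemLp g 2 (volume.restrict Ω)}

/-- The Sobolev space `H¹₀(Ω)`: the closure of `C₀^∞(Ω)` in the norm of `H¹(Ω)`. -/
def sobolevH10 (Ω : Set ℝ) : Set (ℝ → ℂ) :=
  {f | MemLp f 2 (volume.restrict Ω) ∧
    ∃ g, HasWeakDeriv Ω f g ∧ MemLp g 2 (volume.restrict Ω) ∧
      ∀ ε : ℝ≥0∞, 0 < ε → ∃ φ ∈ testFunctions Ω,
        eLpNorm (f - φ) 2 (volume.restrict Ω) < ε ∧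
        eLpNorm (g - deriv φ) 2 (volume.restrict Ω) < ε}

/-- The domain of the quadratic form `Q_{S_{0,D,N}}`: functions `f ∈ L²((0,π))`, locally absolutely
continuous in `(0,π)`, with `f'(π) = 0` (left derivative, which also makes `f π` the left limit
of `f` at `π`), and such that `f' - f / (2x)` belongs to `L²((0,π))`. -/
def formDomainDN : Set (ℝ → ℂ) :=
  {f | MemLp f 2 (volume.restrict (Ioo 0 Real.pi)) ∧
    (∀ a b : ℝ, 0 < a → a ≤ b → b < Real.pi → AbsolutelyContinuousOnInterval f a b) ∧
    HasDerivWithinAt f 0 (Iio Real.pi) Real.pi ∧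
    MemLp (fun x : ℝ => deriv f x - f x / (2 * (x : ℂ))) 2 (volume.restrict (Ioo 0 Real.pi))}

/-- The distance from `x ∈ (0,π)` to the boundary `{0,π}`. -/
noncomputable def distBoundary (x : ℝ) : ℝ := if x ≤ Real.pi / 2 then x else Real.pi - x

/-- The inequality `∫ |f'|² ≥ a ∫ |f|² / w² + c ∫ |f|²` (integrals over `(0,π)`) holds for all `f`
in the class `D`, it is strict for `f ≢ 0`, and both constants are optimal on `D`: for `a' > a`
no inequality of this type holds with `a'` in place of `a` (whatever the constant in front of
`∫ |f|²`), and `c` cannot be replaced by any `c' > c`. Here `g` is the derivative of `f`. -/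
structure IsSharpStrictHardy (D : Set (ℝ → ℂ)) (w : ℝ → ℝ) (a c : ℝ) : Prop where
  integrable : ∀ f ∈ D, IntegrableOn (fun x => ‖f x‖ ^ 2 / w x ^ 2) (Ioo 0 Real.pi)
  le : ∀ f ∈ D, ∀ g, HasWeakDeriv (Ioo 0 Real.pi) f g →
    a * (∫ x in Ioo 0 Real.pi, ‖f x‖ ^ 2 / w x ^ 2) + c * (∫ x in Ioo 0 Real.pi, ‖f x‖ ^ 2)
      ≤ ∫ x in Ioo 0 Real.pi, ‖g x‖ ^ 2
  lt : ∀ f ∈ D, ∀ g, HasWeakDeriv (Ioo 0 Real.pi) f g →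
    ¬ f =ᵐ[volume.restrict (Ioo 0 Real.pi)] 0 →
    a * (∫ x in Ioo 0 Real.pi, ‖f x‖ ^ 2 / w x ^ 2) + c * (∫ x in Ioo 0 Real.pi, ‖f x‖ ^ 2)
      < ∫ x in Ioo 0 Real.pi, ‖g x‖ ^ 2
  optimal_left : ∀ a' > a, ∀ c' : ℝ, ∃ f ∈ D, ∃ g, HasWeakDeriv (Ioo 0 Real.pi) f g ∧
    ∫ x in Ioo 0 Real.pi, ‖g x‖ ^ 2 <
      a' * (∫ x in Ioo 0 Real.pi, ‖f x‖ ^ 2 / w x ^ 2) + c' * (∫ x in Ioo 0 Real.pi, ‖f x‖ ^ 2)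
  optimal_right : ∀ c' > c, ∃ f ∈ D, ∃ g, HasWeakDeriv (Ioo 0 Real.pi) f g ∧
    ∫ x in Ioo 0 Real.pi, ‖g x‖ ^ 2 <
      a * (∫ x in Ioo 0 Real.pi, ‖f x‖ ^ 2 / w x ^ 2) + c' * (∫ x in Ioo 0 Real.pi, ‖f x‖ ^ 2)

/-!
The mechanism is the ground state representation. Let `u(x) = √x J₀(kx)`, which solves
`-u'' - u/(4x²) = k² u`, and let `w = u'/u` (`besselW`), a solution of the Riccati equation
`w' + w² = -1/(4x²) - k²` wherever `J₀(kx) ≠ 0`. If `F` is the primitive, vanishing at `0`, of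
`g ∈ L²((0,b))` (`IsL2Primitive`), then completing the square gives

  `∫ |g|² = ∫ (1/(4x²) + k²) |F|² + ∫ |g - w F|²`

up to the boundary terms `w |F|²` (`IsL2Primitive.ground_state_identity_Ioo`). At `0` the boundary
term vanishes since `w ~ 1/(2x)` and `|F|² = o(x)` by Cauchy–Schwarz. At `b` it vanishes in two
cases: if `kb` is Lamb's constant, because then `w(b) = 0`; and if `kb` is the first zero of `J₀`
and `F(b) = 0`, because `w` is of order `1/(b - x)` and `|F|² = o(b - x)`. Lamb's constant lies
below the first zero of `J₀`, so `u > 0` on `(0,b)` in both cases. Equality forces `g = w F`, so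
`F` is a multiple of `u`; but `|u|²/x → 1` at `0`, so `F = 0` (`IsL2Primitive.bessel_hardy`).

The function spaces are reduced to such primitives: elements of `H¹₀` are, up to null sets,
exactly the primitives vanishing at both endpoints, and elements of the Dirichlet–Neumann domain in
`H¹` are primitives vanishing at `0`, by the lemma of du Bois-Reymond. The inequality with the
distance to the boundary is the sum of the inequalities on the two halves of the interval, each
with a free endpoint at the midpoint.

Both constants are optimal because of the trial functions `u χ` with `χ = (x e^{-x/b})^ε`
(`exists_besselTrial`). For these `∫ |g - w F|² = ∫ u² |χ'|²`, which is `O(ε)`, while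
`∫ |F|²/x²` grows like `1/ε` and `∫ |F|²` stays bounded above and below. Since `χ'(b) = 0`, they
satisfy the Neumann condition whenever `u` does, and their even extension across `b` serves for
the distance to the boundary.
-/

open Filter Topology

/-! ### The Bessel functions `J₀` and `J₁` -/

/-- The entire function `Eₙ(z) = ∑ (-1)ᵏ zᵏ / (k! (k+n)!)`, so that `Jₙ(x) = (x/2)ⁿ Eₙ(x²/4)`. -/
noncomputable def besselE (n : ℕ) (z : ℝ) : ℝ :=
  ∑' k : ℕ, (-1 : ℝ) ^ k / ((k.factorial : ℝ) * ((k + n).factorial : ℝ)) * z ^ k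

lemma summable_besselE (n : ℕ) (z : ℝ) :
    Summable fun k : ℕ =>
      (-1 : ℝ) ^ k / ((k.factorial : ℝ) * ((k + n).factorial : ℝ)) * z ^ k := by
  refine Summable.of_norm_bounded (Real.summable_pow_div_factorial |z|) fun k => ?_
  have h1 : (1 : ℝ) ≤ (k + n).factorial := by
    exact_mod_cast Nat.one_le_iff_ne_zero.2 (by positivity)
  have h0 : (0 : ℝ) < k.factorial := by positivity
  rw [norm_mul, norm_div, norm_pow, norm_neg, norm_one, one_pow, norm_pow, Real.norm_eq_abs z,
    Real.norm_of_nonneg (by positivity), one_div_mul_eq_div]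
  exact div_le_div_of_nonneg_left (by positivity) h0 (by nlinarith)

lemma besselE_succ_term (n k : ℕ) (z : ℝ) :
    (-1 : ℝ) ^ (k + 1) / (((k + 1).factorial : ℝ) * ((k + 1 + n).factorial : ℝ)) *
      ((k + 1 : ℕ) * z ^ k) =
    -((-1 : ℝ) ^ k / ((k.factorial : ℝ) * ((k + (n + 1)).factorial : ℝ)) * z ^ k) := by
  have h : k + (n + 1) = k + 1 + n := by ring
  rw [h, Nat.factorial_succ k]
  push_cast
  have h0 : (k.factorial : ℝ) ≠ 0 := by positivity
  have h1 : ((k + 1 + n).factorial : ℝ) ≠ 0 := by positivity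
  field_simp
  ring

lemma hasDerivAt_besselE (n : ℕ) (z : ℝ) : HasDerivAt (besselE n) (-besselE (n + 1) z) z := by
  set R := |z| + 1
  set a : ℕ → ℝ := fun k => (-1 : ℝ) ^ k / ((k.factorial : ℝ) * ((k + n).factorial : ℝ)) with ha
  have hR : 0 < R := by positivity
  have hu : Summable fun k : ℕ => |a k * (k * R ^ (k - 1))| := by
    rw [← summable_nat_add_iff 1]
    have := (summable_besselE (n + 1) R).abs
    refine this.congr fun k => ?_
    have := besselE_succ_term n k R
    simp only [ha, Nat.add_sub_cancel]
    rw [this, abs_neg]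
  have hd := hasDerivAt_tsum_of_isPreconnected (u := fun k : ℕ => |a k * (k * R ^ (k - 1))|)
    (t := Ioo (-R) R) (g := fun k z => a k * z ^ k)
    (g' := fun k z => a k * (k * z ^ (k - 1))) (y₀ := 0) (y := z) hu isOpen_Ioo
    isPreconnected_Ioo (fun k y _ => (hasDerivAt_pow k y).const_mul (a k))
    (fun k y hy => ?_) ⟨by linarith, hR⟩ (summable_besselE n 0)
    (abs_lt.1 (by simp [R]))
  · have hs : Summable fun k : ℕ => a k * (k * z ^ (k - 1)) := by
      rw [← summable_nat_add_iff 1]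
      refine (summable_besselE (n + 1) z).neg.congr fun k => ?_
      simp only [ha, Nat.add_sub_cancel]
      rw [besselE_succ_term]
    convert! hd using 1
    rw [hs.tsum_eq_zero_add, besselE, ← tsum_neg]
    simp only [Nat.cast_zero, zero_mul, mul_zero, zero_add]
    refine tsum_congr fun k => ?_
    simp only [ha, Nat.add_sub_cancel]
    rw [besselE_succ_term]
  · simp only [norm_mul, abs_mul, Real.norm_eq_abs, abs_pow]
    rw [abs_of_pos hR]
    gcongr
    exact (abs_lt.2 hy).le

lemma besselE_recurrence (z : ℝ) : besselE 1 z - z * besselE 2 z = besselE 0 z := by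
  have h0 := (summable_besselE 0 z).tsum_eq_zero_add
  have h1 := (summable_besselE 1 z).tsum_eq_zero_add
  have s1 := (summable_nat_add_iff 1).2 (summable_besselE 1 z)
  have s2 := (summable_besselE 2 z).mul_left z
  unfold besselE
  rw [h0, h1, ← tsum_mul_left, add_sub_assoc, ← s1.tsum_sub s2]
  simp only [Nat.factorial_zero, zero_add, Nat.factorial_one, pow_zero, add_zero]
  congr 1
  refine tsum_congr fun k => ?_
  rw [show k + 1 + 1 = k + 2 by ring, Nat.factorial_succ (k + 1), Nat.factorial_succ k]
  have h0 : (k.factorial : ℝ) ≠ 0 := by positivity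
  push_cast
  field_simp
  ring

lemma besselJ_eq_besselE (n : ℕ) (x : ℝ) : besselJ n x = (x / 2) ^ n * besselE n ((x / 2) ^ 2) := by
  unfold besselJ besselE
  rw [← tsum_mul_left]
  refine tsum_congr fun k => ?_
  rw [pow_add, pow_mul]
  ring

lemma besselJ_zero_zero : besselJ 0 0 = 1 := by
  rw [besselJ_eq_besselE, besselE, tsum_eq_single 0]
  · simp
  · intro k hk; simp [hk]

lemma hasDerivAt_besselJ_zero (x : ℝ) : HasDerivAt (besselJ 0) (-besselJ 1 x) x := by
  have h : besselJ 0 = fun x => besselE 0 ((x / 2) ^ 2) := by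
    ext x; simp [besselJ_eq_besselE]
  have h2 : HasDerivAt (fun x : ℝ => (x / 2) ^ 2) (x / 2) x := by
    convert! ((hasDerivAt_id x).div_const 2).pow 2 using 1
    simp
    ring
  rw [h, besselJ_eq_besselE]
  convert! (hasDerivAt_besselE 0 ((x / 2) ^ 2)).comp x h2 using 1
  ring

lemma hasDerivAt_mul_besselJ_one (x : ℝ) :
    HasDerivAt (fun x => x * besselJ 1 x) (x * besselJ 0 x) x := by
  have h : (fun x => x * besselJ 1 x) = fun x => 2 * ((x / 2) ^ 2 * besselE 1 ((x / 2) ^ 2)) := by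
    ext x; simp [besselJ_eq_besselE]; ring
  have h2 : HasDerivAt (fun x : ℝ => (x / 2) ^ 2) (x / 2) x := by
    convert! ((hasDerivAt_id x).div_const 2).pow 2 using 1
    simp
    ring
  rw [h, besselJ_eq_besselE]
  convert! (h2.mul ((hasDerivAt_besselE 1 ((x / 2) ^ 2)).comp x h2)).const_mul 2 using 1
  simp only [Function.comp]
  rw [← besselE_recurrence]
  ring

lemma continuous_besselJ_zero : Continuous (besselJ 0) :=
  continuous_iff_continuousAt.2 fun x => (hasDerivAt_besselJ_zero x).continuousAt

lemma continuous_besselJ_one : Continuous (besselJ 1) := by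
  have h : Continuous (besselE 1) :=
    continuous_iff_continuousAt.2 fun x => (hasDerivAt_besselE 1 x).continuousAt
  have : besselJ 1 = fun x => (x / 2) ^ 1 * besselE 1 ((x / 2) ^ 2) := by
    ext x; exact besselJ_eq_besselE 1 x
  rw [this]
  fun_prop

/-- `E₀(2) = J₀(2√2)`, whose partial sum `1 - 2 + 1 - 2/9` of the series is already negative. -/
lemma besselE_zero_two_neg : besselE 0 2 < 0 := by
  have hs := summable_besselE 0 2
  have h := hs.sum_add_tsum_nat_add 4
  -- the terms beyond the fourth are dominated by a geometric series of sum `1/18`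
  have ht : ‖∑' k : ℕ, (-1 : ℝ) ^ (k + 4) / (((k + 4).factorial : ℝ) *
      ((k + 4 + 0).factorial : ℝ)) * 2 ^ (k + 4)‖ ≤ 1 / 18 := by
    have hg : HasSum (fun k : ℕ => (1 / 36 : ℝ) * (1 / 2) ^ k) (1 / 18) := by
      convert! hasSum_geometric_two.mul_left (1 / 36 : ℝ) using 1
      norm_num
    refine tsum_of_norm_bounded hg fun k => ?_
    rw [norm_mul, norm_div, norm_pow, norm_neg, norm_one, one_pow, norm_pow,
      Real.norm_of_nonneg (by positivity), add_zero, Real.norm_of_nonneg (by norm_num : (0:ℝ) ≤ 2)]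
    induction k with
    | zero => norm_num [Nat.factorial]
    | succ k ih =>
      rw [show k + 1 + 4 = (k + 4) + 1 by ring, Nat.factorial_succ (k + 4), pow_succ,
        pow_succ (1 / 2 : ℝ)]
      push_cast
      have hf : (0 : ℝ) < (k + 4).factorial := by positivity
      have h2 : (2 : ℝ) / (((k : ℝ) + 4 + 1) * ((k : ℝ) + 4 + 1)) ≤ 1 / 2 := by
        rw [div_le_div_iff₀ (by positivity) (by norm_num)]
        have : (0 : ℝ) ≤ k := by positivity
        nlinarith
      calc _ = (1 / (((k + 4).factorial : ℝ) * (k + 4).factorial) * 2 ^ (k + 4)) *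
            ((2 : ℝ) / (((k : ℝ) + 4 + 1) * ((k : ℝ) + 4 + 1))) := by field_simp
        _ ≤ (1 / 36 * (1 / 2) ^ k) * (1 / 2) := by gcongr
        _ = _ := by ring
  have ht' := (abs_le.1 ht).2
  rw [besselE, ← h]
  norm_num [Finset.sum_range_succ, Nat.factorial] at ht' ⊢
  linarith

lemma exists_besselJ_zero_neg : ∃ x > 0, besselJ 0 x < 0 := by
  -- `2√2` is chosen because `(x/2)² = 2` there
  refine ⟨2 * √2, by positivity, ?_⟩
  rw [besselJ_eq_besselE, pow_zero, one_mul, mul_div_cancel_left₀ _ two_ne_zero,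
    Real.sq_sqrt (by norm_num)]
  exact besselE_zero_two_neg

/-- The positive zeros of a continuous function that does not vanish at `0` have a least element
as soon as there is one. -/
lemma isLeast_positive_zeros {φ : ℝ → ℝ} (hφ : Continuous φ) (h0 : φ 0 ≠ 0)
    (hne : {x | 0 < x ∧ φ x = 0}.Nonempty) :
    IsLeast {x | 0 < x ∧ φ x = 0} (sInf {x | 0 < x ∧ φ x = 0}) := by
  have hc : IsClosed {x | 0 < x ∧ φ x = 0} := by
    have : {x | 0 < x ∧ φ x = 0} = Ici 0 ∩ φ ⁻¹' {0} := by
      ext x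
      simp only [mem_ofPred_eq, mem_inter_iff, mem_Ici, mem_preimage, mem_singleton_iff]
      refine ⟨fun h => ⟨h.1.le, h.2⟩, fun h => ⟨lt_of_le_of_ne h.1 ?_, h.2⟩⟩
      rintro rfl
      exact h0 h.2
    rw [this]
    exact isClosed_Ici.inter (isClosed_singleton.preimage hφ)
  have hb : BddBelow {x | 0 < x ∧ φ x = 0} := ⟨0, fun x hx => hx.1.le⟩
  exact ⟨hc.csInf_mem hne hb, fun x hx => csInf_le hb hx⟩

/-- Before its least positive zero, a continuous function keeps the sign it has at `0`. -/
lemma pos_of_lt_isLeast_zero {φ : ℝ → ℝ} {j : ℝ} (hφ : Continuous φ) (h0 : 0 < φ 0)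
    (hj : IsLeast {x | 0 < x ∧ φ x = 0} j) {x : ℝ} (hx0 : 0 ≤ x) (hx : x < j) : 0 < φ x := by
  by_contra! h
  obtain ⟨y, hy, hy0⟩ := intermediate_value_Icc' hx0 hφ.continuousOn ⟨h, h0.le⟩
  have hypos : 0 < y := lt_of_le_of_ne hy.1 (by rintro rfl; exact h0.ne' hy0)
  exact absurd (hj.2 ⟨hypos, hy0⟩) (by linarith [hy.2])

lemma exists_zero_of_neg {φ : ℝ → ℝ} (hφ : Continuous φ) (h0 : 0 < φ 0) {x : ℝ} (hx : 0 < x)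
    (hneg : φ x < 0) : {x | 0 < x ∧ φ x = 0}.Nonempty := by
  obtain ⟨y, hy, hy0⟩ := intermediate_value_Icc' hx.le hφ.continuousOn ⟨hneg.le, h0.le⟩
  exact ⟨y, lt_of_le_of_ne hy.1 (by rintro rfl; exact h0.ne' hy0), hy0⟩

lemma isLeast_besselJ0Zeros : IsLeast besselJ0Zeros (sInf besselJ0Zeros) := by
  obtain ⟨x, hx, hneg⟩ := exists_besselJ_zero_neg
  exact isLeast_positive_zeros continuous_besselJ_zero (by simp [besselJ_zero_zero])
    (exists_zero_of_neg continuous_besselJ_zero (by simp [besselJ_zero_zero]) hx hneg)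

lemma besselJ_zero_pos {x : ℝ} (hx0 : 0 ≤ x) (hx : x < sInf besselJ0Zeros) : 0 < besselJ 0 x :=
  pos_of_lt_isLeast_zero continuous_besselJ_zero (by simp [besselJ_zero_zero])
    isLeast_besselJ0Zeros hx0 hx

/-- `x J₁(x)` has derivative `x J₀(x)`, hence increases up to the first zero of `J₀`. -/
lemma besselJ_one_pos_at_zero : 0 < besselJ 1 (sInf besselJ0Zeros) := by
  set j := sInf besselJ0Zeros with hjdef
  have hj : 0 < j := isLeast_besselJ0Zeros.1.1
  have hm : StrictMonoOn (fun x => x * besselJ 1 x) (Icc 0 j) := by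
    refine strictMonoOn_of_deriv_pos (convex_Icc 0 j)
      (continuous_id.mul continuous_besselJ_one).continuousOn fun x hx => ?_
    rw [interior_Icc] at hx
    rw [(hasDerivAt_mul_besselJ_one x).deriv]
    exact mul_pos hx.1 (besselJ_zero_pos hx.1.le hx.2)
  have := hm (left_mem_Icc.2 hj.le) (right_mem_Icc.2 hj.le) hj
  simp only [zero_mul] at this
  exact (pos_iff_pos_of_mul_pos this).1 hj

lemma continuous_lamb : Continuous fun x => besselJ 0 x - 2 * x * besselJ 1 x := by
  have h0 := continuous_besselJ_zero
  have h1 := continuous_besselJ_one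
  fun_prop

/-- At the first zero of `J₀` only the term `-2xJ₁(x) < 0` survives; hence Lamb's constant exists
and is smaller than that zero. -/
lemma lamb_neg_at_besselJ0Zero :
    besselJ 0 (sInf besselJ0Zeros) -
      2 * sInf besselJ0Zeros * besselJ 1 (sInf besselJ0Zeros) < 0 := by
  have h1 := isLeast_besselJ0Zeros.1.1
  have h2 := isLeast_besselJ0Zeros.1.2
  have h3 := mul_pos h1 besselJ_one_pos_at_zero
  rw [h2]
  linarith

lemma isLeast_lambZeros : IsLeast lambZeros lambConstant :=
  isLeast_positive_zeros continuous_lamb (by simp [besselJ_zero_zero])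
    (exists_zero_of_neg continuous_lamb (by simp [besselJ_zero_zero])
      isLeast_besselJ0Zeros.1.1 lamb_neg_at_besselJ0Zero)

lemma lambConstant_lt : lambConstant < sInf besselJ0Zeros := by
  by_contra! h
  rcases h.lt_or_eq with h | h
  · have := pos_of_lt_isLeast_zero continuous_lamb (by simp [besselJ_zero_zero])
      isLeast_lambZeros isLeast_besselJ0Zeros.1.1.le h
    linarith [lamb_neg_at_besselJ0Zero]
  · have h1 := isLeast_lambZeros.1.2
    rw [← h] at h1
    linarith [lamb_neg_at_besselJ0Zero]

/-! ### Primitives of integrable functions -/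

lemma AbsolutelyContinuousOnInterval.congr_uIcc {f g : ℝ → ℂ} {a b : ℝ}
    (hf : AbsolutelyContinuousOnInterval f a b) (h : EqOn f g (uIcc a b)) :
    AbsolutelyContinuousOnInterval g a b := by
  rw [absolutelyContinuousOnInterval_iff] at hf ⊢
  intro ε hε
  obtain ⟨δ, hδ, H⟩ := hf ε hε
  refine ⟨δ, hδ, fun E hE hlt => ?_⟩
  refine lt_of_eq_of_lt (Finset.sum_congr rfl fun i hi => ?_) (H E hE hlt)
  have := hE.1 i hi
  rw [h this.1, h this.2]

lemma IntervalIntegrable.absolutelyContinuousOnInterval_integral_complex {g : ℝ → ℂ} {a b : ℝ}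
    (hab : a ≤ b) (hg : IntervalIntegrable g volume a b) :
    AbsolutelyContinuousOnInterval (fun x => ∫ t in a..x, g t) a b := by
  have hre : IntervalIntegrable (fun t => (g t).re) volume a b := ⟨hg.1.re, hg.2.re⟩
  have him : IntervalIntegrable (fun t => (g t).im) volume a b := ⟨hg.1.im, hg.2.im⟩
  have h1 := hre.absolutelyContinuousOnInterval_intervalIntegral (c := a) (by simp)
  have h2 := him.absolutelyContinuousOnInterval_intervalIntegral (c := a) (by simp)
  have e1 : LipschitzOnWith 1 (fun _ : ℝ => (1 : ℂ)) (uIcc a b) := by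
    intro x _ y _; simp
  have e2 : LipschitzOnWith 1 (fun _ : ℝ => Complex.I) (uIcc a b) := by
    intro x _ y _; simp
  refine ((h1.smul e1.absolutelyContinuousOnInterval).add
    (h2.smul e2.absolutelyContinuousOnInterval)).congr_uIcc fun x hx => ?_
  rw [uIcc_of_le hab] at hx
  have hgx : IntervalIntegrable g volume a x :=
    hg.mono_set (by rw [uIcc_of_le hx.1, uIcc_of_le hab]; exact Icc_subset_Icc_right hx.2)
  have e3 : ∫ t in a..x, (g t).re = (∫ t in a..x, g t).re := by
    simp only [intervalIntegral.integral_of_le hx.1]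
    exact integral_re hgx.1
  have e4 : ∫ t in a..x, (g t).im = (∫ t in a..x, g t).im := by
    simp only [intervalIntegral.integral_of_le hx.1]
    exact integral_im hgx.1
  simp only [Pi.add_apply, Pi.smul_apply', e3, e4, Complex.real_smul, mul_one]
  exact Complex.re_add_im _

/-- `F` is on `[a,b]` a primitive of the integrable function `g`; equivalently, `F` is absolutely
continuous on `[a,b]` with derivative `g` almost everywhere. -/
structure IsPrimitiveOn (F g : ℝ → ℂ) (a b : ℝ) : Prop where
  le : a ≤ b
  intervalIntegrable : IntervalIntegrable g volume a b
  eq_integral : ∀ x ∈ Icc a b, F x = F a + ∫ t in a..x, g t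

namespace IsPrimitiveOn

variable {F g G h : ℝ → ℂ} {a b : ℝ}

lemma integral_eq_sub (hF : IsPrimitiveOn F g a b) : ∫ t in a..b, g t = F b - F a := by
  rw [hF.eq_integral b (right_mem_Icc.2 hF.le)]
  ring

lemma absolutelyContinuousOnInterval (hF : IsPrimitiveOn F g a b) :
    AbsolutelyContinuousOnInterval F a b := by
  have e : LipschitzOnWith 1 (fun _ : ℝ => F a) (uIcc a b) := by
    intro x _ y _; simp
  refine (e.absolutelyContinuousOnInterval.add
    (hF.intervalIntegrable.absolutelyContinuousOnInterval_integral_complex hF.le)).congr_uIcc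
    fun x hx => ?_
  rw [uIcc_of_le hF.le] at hx
  exact (hF.eq_integral x hx).symm

lemma continuousOn (hF : IsPrimitiveOn F g a b) : ContinuousOn F (Icc a b) := by
  simpa [uIcc_of_le hF.le] using hF.absolutelyContinuousOnInterval.continuousOn

lemma ae_hasDerivAt (hF : IsPrimitiveOn F g a b) :
    ∀ᵐ x, x ∈ uIcc a b → HasDerivAt F (g x) x := by
  have hae : ∀ᵐ x : ℝ, x ≠ a ∧ x ≠ b := by
    have h1 : ∀ᵐ x : ℝ, x ≠ a := by simp [ae_iff]
    have h2 : ∀ᵐ x : ℝ, x ≠ b := by simp [ae_iff]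
    filter_upwards [h1, h2] with x h1 h2 using ⟨h1, h2⟩
  filter_upwards [hF.intervalIntegrable.ae_hasDerivAt_integral, hae] with x hx hne hxm
  have h1 := (hx hxm a (by simp)).const_add (F a)
  rw [uIcc_of_le hF.le] at hxm
  refine h1.congr_of_eventuallyEq ?_
  filter_upwards [Icc_mem_nhds (lt_of_le_of_ne hxm.1 hne.1.symm) (lt_of_le_of_ne hxm.2 hne.2)]
    with y hy using hF.eq_integral y hy

/-- The fundamental theorem of calculus for complex-valued absolutely continuous functions. -/
lemma of_ae_hasDerivAt (hab : a ≤ b) (hF : AbsolutelyContinuousOnInterval F a b)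
    (hg : IntervalIntegrable g volume a b) (hd : ∀ᵐ x, x ∈ uIcc a b → HasDerivAt F (g x) x) :
    IsPrimitiveOn F g a b := by
  refine ⟨hab, hg, ?_⟩
  have hK := hF.sub (hg.absolutelyContinuousOnInterval_integral_complex hab)
  have hK0 : ∀ᵐ x, x ∈ uIcc a b → HasDerivAt (F - fun x => ∫ t in a..x, g t) 0 x := by
    filter_upwards [hd, hg.ae_hasDerivAt_integral] with x h1 h2 hx
    have := (h1 hx).sub (h2 hx a (by simp))
    rwa [sub_self] at this
  obtain ⟨C, hC⟩ := hK.const_of_ae_hasDerivAt_zero hK0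
  intro x hx
  have h1 := hC x (by rwa [uIcc_of_le hab])
  have h2 := hC a (by simp)
  simp only [Pi.sub_apply, intervalIntegral.integral_same, sub_zero] at h1 h2
  rw [h2, ← h1]
  ring

lemma of_hasDerivAt (hab : a ≤ b) (hd : ∀ x ∈ Icc a b, HasDerivAt F (g x) x)
    (hg : ContinuousOn g (Icc a b)) : IsPrimitiveOn F g a b := by
  have hg' : IntervalIntegrable g volume a b :=
    ContinuousOn.intervalIntegrable (by rwa [uIcc_of_le hab])
  refine ⟨hab, hg', fun x hx => ?_⟩
  have hsub : uIcc a x ⊆ Icc a b := by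
    rw [uIcc_of_le hx.1]; exact Icc_subset_Icc_right hx.2
  rw [intervalIntegral.integral_eq_sub_of_hasDerivAt (fun y hy => hd y (hsub hy))
    (hg.mono hsub).intervalIntegrable]
  ring

lemma mul (hF : IsPrimitiveOn F g a b) (hG : IsPrimitiveOn G h a b) :
    IsPrimitiveOn (fun x => F x * G x) (fun x => g x * G x + F x * h x) a b := by
  have hcF : ContinuousOn F (uIcc a b) := hF.absolutelyContinuousOnInterval.continuousOn
  have hcG : ContinuousOn G (uIcc a b) := hG.absolutelyContinuousOnInterval.continuousOn
  refine of_ae_hasDerivAt hF.le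
    (hF.absolutelyContinuousOnInterval.smul hG.absolutelyContinuousOnInterval)
    ((hF.intervalIntegrable.mul_continuousOn hcG).add
      (hG.intervalIntegrable.continuousOn_mul hcF)) ?_
  filter_upwards [hF.ae_hasDerivAt, hG.ae_hasDerivAt] with x h1 h2 hx
  exact (h1 hx).mul (h2 hx)

lemma conj (hF : IsPrimitiveOn F g a b) :
    IsPrimitiveOn (fun x => (starRingEnd ℂ) (F x)) (fun x => (starRingEnd ℂ) (g x)) a b := by
  refine ⟨hF.le, ?_, fun x hx => ?_⟩
  · exact ⟨Complex.conjCLE.toContinuousLinearMap.integrable_comp hF.intervalIntegrable.1,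
      Complex.conjCLE.toContinuousLinearMap.integrable_comp hF.intervalIntegrable.2⟩
  · rw [hF.eq_integral x hx, map_add]
    congr 1
    simp only [intervalIntegral.integral_of_le hx.1]
    exact integral_conj.symm

end IsPrimitiveOn

/-- The Cauchy–Schwarz inequality `|∫ g|² ≤ (b - a) ∫ |g|²` on an interval. -/
lemma norm_integral_sq_le {g : ℝ → ℂ} {a b : ℝ} (hab : a ≤ b)
    (hg : IntervalIntegrable g volume a b)
    (hg2 : IntervalIntegrable (fun x => ‖g x‖ ^ 2) volume a b) :
    ‖∫ t in a..b, g t‖ ^ 2 ≤ (b - a) * ∫ t in a..b, ‖g t‖ ^ 2 := by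
  rcases hab.eq_or_lt with rfl | hlt
  · simp
  have hba : 0 < b - a := sub_pos.2 hlt
  set I := ∫ t in a..b, ‖g t‖ with hI
  have h1 : ‖∫ t in a..b, g t‖ ≤ I := intervalIntegral.norm_integral_le_integral_norm hab
  have h2 : 0 ≤ ∫ t in a..b, (‖g t‖ - I / (b - a)) ^ 2 :=
    intervalIntegral.integral_nonneg hab fun t _ => sq_nonneg _
  have h3 : ∫ t in a..b, (‖g t‖ - I / (b - a)) ^ 2 =
      (∫ t in a..b, ‖g t‖ ^ 2) - 2 * (I / (b - a)) * I + (b - a) * (I / (b - a)) ^ 2 := by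
    have e : ∀ t, (‖g t‖ - I / (b - a)) ^ 2 =
        ‖g t‖ ^ 2 - 2 * (I / (b - a)) * ‖g t‖ + (I / (b - a)) ^ 2 := fun t => by ring
    simp_rw [e]
    rw [intervalIntegral.integral_add (hg2.sub (hg.norm.const_mul _)) (by simp),
      intervalIntegral.integral_sub hg2 (hg.norm.const_mul _),
      intervalIntegral.integral_const_mul, intervalIntegral.integral_const, smul_eq_mul]
  have h4 : (b - a) * ((∫ t in a..b, ‖g t‖ ^ 2) - 2 * (I / (b - a)) * I +
      (b - a) * (I / (b - a)) ^ 2) = (b - a) * (∫ t in a..b, ‖g t‖ ^ 2) - I ^ 2 := by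
    field_simp
    ring
  have h5 := mul_nonneg hba.le (h3 ▸ h2)
  rw [h4] at h5
  have h6 : ‖∫ t in a..b, g t‖ ^ 2 ≤ I ^ 2 := by gcongr
  linarith

/-! ### The ground state identity for primitives of square integrable functions -/

/-- On `(0,b)`, the function `F` is the primitive vanishing at `0` of a square integrable
function `g`. The values of `F` outside `(0,b)` are irrelevant. -/
structure IsL2Primitive (b : ℝ) (F g : ℝ → ℂ) : Prop where
  memLp : MemLp g 2 (volume.restrict (Ioo 0 b))
  eq_integral : ∀ x ∈ Ioo 0 b, F x = ∫ t in (0 : ℝ)..x, g t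

namespace IsL2Primitive

variable {b : ℝ} {F g : ℝ → ℂ}

lemma intervalIntegrable (h : IsL2Primitive b F g) (hb : 0 ≤ b) :
    IntervalIntegrable g volume 0 b := by
  rw [intervalIntegrable_iff_integrableOn_Ioo_of_le hb]
  exact h.memLp.integrable (by norm_num)

lemma integrableOn_sq (h : IsL2Primitive b F g) :
    IntegrableOn (fun x => ‖g x‖ ^ 2) (Ioo 0 b) := by
  have := h.memLp.integrable_norm_pow (by norm_num)
  exact this

lemma intervalIntegrable_sq (h : IsL2Primitive b F g) (hb : 0 ≤ b) :
    IntervalIntegrable (fun x => ‖g x‖ ^ 2) volume 0 b := by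
  rw [intervalIntegrable_iff_integrableOn_Ioo_of_le hb]
  exact h.integrableOn_sq

lemma isPrimitiveOn (h : IsL2Primitive b F g) {a c : ℝ} (ha : 0 < a) (hac : a ≤ c) (hc : c < b) :
    IsPrimitiveOn F g a c := by
  have hi := h.intervalIntegrable (by linarith)
  have key : ∀ x ∈ Icc 0 b, ∀ y ∈ Icc 0 b, IntervalIntegrable g volume x y := fun x hx y hy =>
    hi.mono_set (uIcc_subset_uIcc (by rwa [uIcc_of_le (by linarith)])
      (by rwa [uIcc_of_le (by linarith)]))
  have ha' : a ∈ Icc 0 b := ⟨ha.le, by linarith⟩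
  refine ⟨hac, key a ha' c ⟨by linarith, hc.le⟩, fun x hx => ?_⟩
  rw [h.eq_integral x ⟨ha.trans_le hx.1, hx.2.trans_lt hc⟩,
    h.eq_integral a ⟨ha, hac.trans_lt hc⟩,
    intervalIntegral.integral_add_adjacent_intervals (key 0 ⟨le_rfl, by linarith⟩ a ha')
      (key a ha' x ⟨by linarith [hx.1], by linarith [hx.2]⟩)]

lemma continuousOn (h : IsL2Primitive b F g) : ContinuousOn F (Ioo 0 b) := by
  intro x hx
  obtain ⟨a, ha, hax⟩ := exists_between hx.1
  obtain ⟨c, hxc, hc⟩ := exists_between hx.2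
  have := (h.isPrimitiveOn ha (hax.trans hxc).le hc).continuousOn
  exact (this.continuousAt (Icc_mem_nhds hax hxc)).continuousWithinAt

lemma mono (h : IsL2Primitive b F g) {c : ℝ} (hc : c ≤ b) : IsL2Primitive c F g :=
  ⟨h.memLp.mono_measure (Measure.restrict_mono (Ioo_subset_Ioo_right hc) le_rfl),
    fun x hx => h.eq_integral x ⟨hx.1, hx.2.trans_le hc⟩⟩

lemma norm_sq_le (h : IsL2Primitive b F g) {x : ℝ} (hx : x ∈ Ioo 0 b) :
    ‖F x‖ ^ 2 ≤ x * ∫ t in (0 : ℝ)..x, ‖g t‖ ^ 2 := by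
  have hb : 0 ≤ b := (hx.1.trans hx.2).le
  have hsub : uIcc 0 x ⊆ uIcc 0 b := by
    rw [uIcc_of_le hx.1.le, uIcc_of_le hb]; exact Icc_subset_Icc_right hx.2.le
  have := norm_integral_sq_le hx.1.le ((h.intervalIntegrable hb).mono_set hsub)
    ((h.intervalIntegrable_sq hb).mono_set hsub)
  rwa [sub_zero, ← h.eq_integral x hx] at this

lemma tendsto_integral_sq_zero (h : IsL2Primitive b F g) (hb : 0 < b) :
    Tendsto (fun x => ∫ t in (0 : ℝ)..x, ‖g t‖ ^ 2) (𝓝[>] 0) (𝓝 0) := by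
  have hc := intervalIntegral.continuousOn_primitive_interval
    (μ := volume) (f := fun t => ‖g t‖ ^ 2) (a := 0) (b := b)
    (((h.intervalIntegrable_sq hb.le).def'.mono_set_ae (by
      rw [uIoc_of_le hb.le, uIcc_of_le hb.le]; exact Ioc_ae_eq_Icc.symm.le)))
  rw [uIcc_of_le hb.le] at hc
  have := (hc 0 (left_mem_Icc.2 hb.le)).tendsto
  rw [intervalIntegral.integral_same] at this
  refine this.mono_left ?_
  rw [← nhdsWithin_Ioo_eq_nhdsGT hb]
  exact nhdsWithin_mono _ Ioo_subset_Icc_self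

lemma tendsto_norm_sq_div (h : IsL2Primitive b F g) (hb : 0 < b) :
    Tendsto (fun x => ‖F x‖ ^ 2 / x) (𝓝[>] 0) (𝓝 0) := by
  refine squeeze_zero' ?_ ?_ (h.tendsto_integral_sq_zero hb)
  · filter_upwards [self_mem_nhdsWithin] with x hx
    exact div_nonneg (by positivity) (le_of_lt hx)
  · filter_upwards [Ioo_mem_nhdsGT hb] with x hx
    rw [div_le_iff₀ hx.1, mul_comm]
    exact h.norm_sq_le hx

lemma tendsto_left (h : IsL2Primitive b F g) (hb : 0 < b) :
    Tendsto F (𝓝[<] b) (𝓝 (∫ t in (0 : ℝ)..b, g t)) := by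
  have hc := intervalIntegral.continuousOn_primitive_interval
    (μ := volume) (f := g) (a := 0) (b := b)
    (((h.intervalIntegrable hb.le).def'.mono_set_ae (by
      rw [uIoc_of_le hb.le, uIcc_of_le hb.le]; exact Ioc_ae_eq_Icc.symm.le)))
  rw [uIcc_of_le hb.le] at hc
  have := (hc b (right_mem_Icc.2 hb.le)).tendsto
  have h2 : Tendsto (fun x => ∫ t in (0 : ℝ)..x, g t) (𝓝[<] b) (𝓝 (∫ t in (0 : ℝ)..b, g t)) := by
    refine this.mono_left ?_
    rw [← nhdsWithin_Ioo_eq_nhdsLT hb]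
    exact nhdsWithin_mono _ Ioo_subset_Icc_self
  refine h2.congr' ?_
  filter_upwards [Ioo_mem_nhdsLT hb] with x hx using (h.eq_integral x hx).symm

/-- If the primitive also vanishes at `b`, reflecting `(0,b)` gives a primitive of the same kind. -/
lemma reflect (h : IsL2Primitive b F g) (hb : 0 < b) (h0 : ∫ t in (0 : ℝ)..b, g t = 0) :
    IsL2Primitive b (fun x => F (b - x)) (fun x => -g (b - x)) := by
  have hmp : MeasurePreserving (fun x : ℝ => b - x) (volume.restrict (Ioo 0 b))
      (volume.restrict (Ioo 0 b)) := by
    have := (Measure.measurePreserving_sub_left (volume : Measure ℝ) b).restrict_preimage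
      (s := Ioo 0 b) measurableSet_Ioo
    simpa using this
  refine ⟨(h.memLp.comp_measurePreserving hmp).neg, fun x hx => ?_⟩
  have hi := h.intervalIntegrable hb.le
  have h1 : IntervalIntegrable g volume 0 (b - x) := hi.mono_set (by
    rw [uIcc_of_le (by linarith [hx.2]), uIcc_of_le hb.le]
    exact Icc_subset_Icc_right (by linarith [hx.1]))
  have h2 : IntervalIntegrable g volume (b - x) b := hi.mono_set (by
    rw [uIcc_of_le (by linarith [hx.1]), uIcc_of_le hb.le]
    exact Icc_subset_Icc_left (by linarith [hx.2]))
  rw [intervalIntegral.integral_neg, intervalIntegral.integral_comp_sub_left, sub_zero,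
    h.eq_integral (b - x) ⟨by linarith [hx.2], by linarith [hx.1]⟩]
  rw [← intervalIntegral.integral_add_adjacent_intervals h1 h2] at h0
  exact eq_neg_of_add_eq_zero_left h0

/-- The ground state identity on a compact subinterval: if `w` solves the Riccati equation
`w' + w² = -V`, completing the square produces `|g - w F|²` up to boundary terms. -/
lemma ground_state_identity (h : IsL2Primitive b F g) {w V : ℝ → ℝ}
    (hw : ∀ x ∈ Ioo 0 b, HasDerivAt w (-w x ^ 2 - V x) x) (hV : ContinuousOn V (Ioo 0 b))
    {a c : ℝ} (ha : 0 < a) (hac : a ≤ c) (hc : c < b) :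
    IntervalIntegrable (fun x => ‖g x - w x * F x‖ ^ 2) volume a c ∧
    IntervalIntegrable (fun x => ‖g x‖ ^ 2 - V x * ‖F x‖ ^ 2) volume a c ∧
    ∫ x in a..c, ‖g x - w x * F x‖ ^ 2 =
      (∫ x in a..c, (‖g x‖ ^ 2 - V x * ‖F x‖ ^ 2)) + w a * ‖F a‖ ^ 2 - w c * ‖F c‖ ^ 2 := by
  have hsub : Icc a c ⊆ Ioo 0 b := fun x hx => ⟨ha.trans_le hx.1, hx.2.trans_lt hc⟩
  have hwc : ContinuousOn w (Ioo 0 b) := fun x hx => (hw x hx).continuousAt.continuousWithinAt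
  have hW : IsPrimitiveOn (fun x => (w x : ℂ)) (fun x => ((-w x ^ 2 - V x : ℝ) : ℂ)) a c := by
    refine IsPrimitiveOn.of_hasDerivAt hac (fun x hx => (hw x (hsub hx)).ofReal_comp) ?_
    exact (Complex.continuous_ofReal.comp_continuousOn (((hwc.pow 2).neg).sub hV)).mono hsub
  have hF := h.isPrimitiveOn ha hac hc
  have hP := hW.mul (hF.mul hF.conj)
  have hcl : Icc 0 b ⊇ Icc a c := hsub.trans Ioo_subset_Icc_self
  have hg2 : IntervalIntegrable (fun x => ‖g x‖ ^ 2) volume a c :=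
    (h.intervalIntegrable_sq (by linarith)).mono_set (by
      rw [uIcc_of_le hac, uIcc_of_le (by linarith)]; exact hcl)
  have hVF : IntervalIntegrable (fun x => V x * ‖F x‖ ^ 2) volume a c := by
    refine ContinuousOn.intervalIntegrable ?_
    rw [uIcc_of_le hac]
    exact ((hV.mono hsub).mul ((hF.continuousOn.norm).pow 2))
  have hpt : ∀ x, ‖g x - w x * F x‖ ^ 2 = (‖g x‖ ^ 2 - V x * ‖F x‖ ^ 2) -
      (((-w x ^ 2 - V x : ℝ) : ℂ) * (F x * (starRingEnd ℂ) (F x)) +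
        (w x : ℂ) * (g x * (starRingEnd ℂ) (F x) + F x * (starRingEnd ℂ) (g x))).re := by
    intro x
    simp only [← Complex.normSq_eq_norm_sq, Complex.normSq_apply, Complex.add_re, Complex.mul_re,
      Complex.mul_im, Complex.sub_re, Complex.sub_im, Complex.add_im, Complex.conj_re,
      Complex.conj_im, Complex.ofReal_re, Complex.ofReal_im]
    ring
  have hre := hP.intervalIntegrable
  have hre' : IntervalIntegrable (fun x => (((-w x ^ 2 - V x : ℝ) : ℂ) *
      (F x * (starRingEnd ℂ) (F x)) + (w x : ℂ) * (g x * (starRingEnd ℂ) (F x) +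
        F x * (starRingEnd ℂ) (g x))).re) volume a c := ⟨hre.1.re, hre.2.re⟩
  have hQ := hg2.sub hVF
  refine ⟨(hQ.sub hre').congr (fun x _ => (hpt x).symm), hQ, ?_⟩
  simp_rw [hpt]
  rw [intervalIntegral.integral_sub hQ hre']
  have e := congrArg Complex.re hP.integral_eq_sub
  have e' := integral_re hre.1
  simp only [RCLike.re_to_complex] at e'
  rw [intervalIntegral.integral_of_le hac, ← e', ← intervalIntegral.integral_of_le hac] at e
  rw [e]
  simp only [Complex.mul_conj, Complex.normSq_eq_norm_sq, ← Complex.ofReal_mul, Complex.sub_re,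
    Complex.ofReal_re]
  ring

end IsL2Primitive

/-- Exhausting `(0,b)` by the intervals `(b/(n+3), b - b/(n+3)]`. -/
lemma aecover_Ioo_shrink {b : ℝ} :
    AECover (volume.restrict (Ioo 0 b)) atTop
      fun n : ℕ => Ioc (b / (n + 3)) (b - b / (n + 3)) := by
  have h : Tendsto (fun n : ℕ => b / ((n : ℝ) + 3)) atTop (𝓝 0) :=
    tendsto_const_nhds.div_atTop (tendsto_atTop_add_const_right _ _ tendsto_natCast_atTop_atTop)
  have h2 : Tendsto (fun n : ℕ => b - b / ((n : ℝ) + 3)) atTop (𝓝 b) := by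
    simpa using tendsto_const_nhds.sub h
  exact aecover_Ioo_of_Ioc h h2

lemma shrink_bounds {b : ℝ} (hb : 0 < b) (n : ℕ) :
    0 < b / (n + 3) ∧ b / (n + 3) ≤ b - b / (n + 3) ∧ b - b / (n + 3) < b := by
  have h0 : 0 < b / ((n : ℝ) + 3) := by positivity
  refine ⟨h0, ?_, by linarith⟩
  have : b / ((n : ℝ) + 3) ≤ b / 3 := by gcongr; linarith [(Nat.cast_nonneg n : (0 : ℝ) ≤ n)]
  linarith

lemma shrink_subset {b : ℝ} (hb : 0 < b) (n : ℕ) :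
    Ioc (b / ((n : ℝ) + 3)) (b - b / (n + 3)) ⊆ Ioo 0 b := fun _ hx =>
  ⟨(shrink_bounds hb n).1.trans hx.1, hx.2.trans_lt (shrink_bounds hb n).2.2⟩

lemma tendsto_shrink_left {b : ℝ} (hb : 0 < b) :
    Tendsto (fun n : ℕ => b / ((n : ℝ) + 3)) atTop (𝓝[>] 0) :=
  tendsto_nhdsWithin_iff.2 ⟨tendsto_const_nhds.div_atTop
    (tendsto_atTop_add_const_right _ _ tendsto_natCast_atTop_atTop),
    Eventually.of_forall fun n => (shrink_bounds hb n).1⟩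

lemma tendsto_shrink_right {b : ℝ} (hb : 0 < b) :
    Tendsto (fun n : ℕ => b - b / ((n : ℝ) + 3)) atTop (𝓝[<] b) := by
  refine tendsto_nhdsWithin_iff.2 ⟨?_, Eventually.of_forall fun n => (shrink_bounds hb n).2.2⟩
  have := (tendsto_shrink_left hb).mono_right nhdsWithin_le_nhds
  simpa using tendsto_const_nhds.sub this

lemma restrict_restrict_shrink {b : ℝ} (hb : 0 < b) (n : ℕ) (h : ℝ → ℝ) :
    ∫ x in Ioc (b / (n + 3)) (b - b / (n + 3)), h x ∂(volume.restrict (Ioo 0 b)) =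
      ∫ x in (b / (n + 3))..(b - b / (n + 3)), h x := by
  obtain ⟨h1, h2, h3⟩ := shrink_bounds hb n
  rw [intervalIntegral.integral_of_le h2, Measure.restrict_restrict measurableSet_Ioc,
    inter_eq_left.2 (shrink_subset hb n)]

lemma integrableOn_shrink {b : ℝ} (hb : 0 < b) {h : ℝ → ℝ}
    (hi : ∀ a c, 0 < a → a ≤ c → c < b → IntervalIntegrable h volume a c) (n : ℕ) :
    IntegrableOn h (Ioc (b / (n + 3)) (b - b / (n + 3))) (volume.restrict (Ioo 0 b)) := by
  obtain ⟨h1, h2, h3⟩ := shrink_bounds hb n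
  have := (hi _ _ h1 h2 h3).1
  unfold IntegrableOn at this ⊢
  rwa [Measure.restrict_restrict measurableSet_Ioc,
    inter_eq_left.2 (shrink_subset hb n)]

lemma tendsto_integral_shrink {b : ℝ} (hb : 0 < b) {h : ℝ → ℝ} (hi : IntegrableOn h (Ioo 0 b)) :
    Tendsto (fun n : ℕ => ∫ x in (b / (n + 3))..(b - b / (n + 3)), h x) atTop
      (𝓝 (∫ x in Ioo 0 b, h x)) := by
  simp_rw [← restrict_restrict_shrink hb]
  exact aecover_Ioo_shrink.integral_tendsto_of_countably_generated hi

lemma ae_nonneg_restrict {b : ℝ} {h : ℝ → ℝ} (h0 : ∀ x ∈ Ioo 0 b, 0 ≤ h x) :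
    0 ≤ᵐ[volume.restrict (Ioo 0 b)] h := by
  filter_upwards [ae_restrict_mem measurableSet_Ioo] with x hx using h0 x hx

namespace IsL2Primitive

variable {b : ℝ} {F g : ℝ → ℂ}

/-- Hardy's inequality in qualitative form: `|F|²/x²` is integrable. It comes from the ground
state `√x`, that is, `w = 1/(2x)`. -/
lemma integrableOn_norm_sq_div_sq (h : IsL2Primitive b F g) (hb : 0 < b) :
    IntegrableOn (fun x => ‖F x‖ ^ 2 / x ^ 2) (Ioo 0 b) := by
  have hw : ∀ x ∈ Ioo 0 b, HasDerivAt (fun x : ℝ => 1 / (2 * x))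
      (-(1 / (2 * x)) ^ 2 - 1 / (4 * x ^ 2)) x := by
    intro x hx
    have hx0 : x ≠ 0 := hx.1.ne'
    convert! ((hasDerivAt_id x).const_mul 2).inv (by simpa using hx0) using 1
    · ext y; simp
    · simp only [id]; field_simp; ring
  have hV : ContinuousOn (fun x : ℝ => 1 / (4 * x ^ 2)) (Ioo 0 b) := by
    refine continuousOn_const.div (by fun_prop) fun x hx => ?_
    have := hx.1
    positivity
  have hcont : ContinuousOn (fun x => ‖F x‖ ^ 2 / x ^ 2) (Ioo 0 b) :=
    (h.continuousOn.norm.pow 2).div (by fun_prop) fun x hx => by have := hx.1; positivity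
  have hi : ∀ a c, 0 < a → a ≤ c → c < b →
      IntervalIntegrable (fun x => ‖F x‖ ^ 2 / x ^ 2) volume a c := by
    intro a c ha hac hc
    refine (hcont.mono ?_).intervalIntegrable
    rw [uIcc_of_le hac]
    exact fun x hx => ⟨ha.trans_le hx.1, hx.2.trans_lt hc⟩
  refine aecover_Ioo_shrink.integrable_of_integral_bounded_of_nonneg_ae
    (4 * ((∫ x in (0 : ℝ)..b, ‖g x‖ ^ 2) + 1)) (integrableOn_shrink hb hi)
    (ae_nonneg_restrict fun x _ => by positivity) ?_
  have hsmall := (((h.tendsto_norm_sq_div hb).comp (tendsto_shrink_left hb)).eventually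
    (gt_mem_nhds zero_lt_one))
  filter_upwards [hsmall] with n hn
  obtain ⟨h1, h2, h3⟩ := shrink_bounds hb n
  rw [restrict_restrict_shrink hb]
  set a := b / ((n : ℝ) + 3)
  set c := b - a
  obtain ⟨-, hQ, e⟩ := h.ground_state_identity hw hV h1 h2 h3
  have hg2 : IntervalIntegrable (fun x => ‖g x‖ ^ 2) volume a c :=
    (h.intervalIntegrable_sq hb.le).mono_set (by
      rw [uIcc_of_le h2, uIcc_of_le hb.le]; exact Icc_subset_Icc h1.le h3.le)
  have h4 : 0 ≤ ∫ x in a..c, ‖g x - ((1 / (2 * x) : ℝ) : ℂ) * F x‖ ^ 2 :=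
    intervalIntegral.integral_nonneg h2 fun x _ => by positivity
  have h5 : ∫ x in a..c, (‖g x‖ ^ 2 - 1 / (4 * x ^ 2) * ‖F x‖ ^ 2) =
      (∫ x in a..c, ‖g x‖ ^ 2) - 1 / 4 * ∫ x in a..c, ‖F x‖ ^ 2 / x ^ 2 := by
    rw [← intervalIntegral.integral_const_mul, ← intervalIntegral.integral_sub hg2
      ((hi a c h1 h2 h3).const_mul _)]
    refine intervalIntegral.integral_congr fun x _ => ?_
    ring
  have h6 : ∫ x in a..c, ‖g x‖ ^ 2 ≤ ∫ x in (0 : ℝ)..b, ‖g x‖ ^ 2 :=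
    intervalIntegral.integral_mono_interval h1.le h2 h3.le
      (Eventually.of_forall fun x => by positivity) (h.intervalIntegrable_sq hb.le)
  have h7 : 1 / (2 * a) * ‖F a‖ ^ 2 ≤ 1 / 2 := by
    have : 1 / (2 * a) * ‖F a‖ ^ 2 = 1 / 2 * (‖F a‖ ^ 2 / a) := by field_simp
    rw [this]
    change ‖F a‖ ^ 2 / a < 1 at hn
    linarith
  have h8 : 0 ≤ 1 / (2 * c) * ‖F c‖ ^ 2 := by
    have : 0 < c := h1.trans_le h2
    positivity
  linarith

lemma integrableOn_norm_sq (h : IsL2Primitive b F g) (hb : 0 < b) :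
    IntegrableOn (fun x => ‖F x‖ ^ 2) (Ioo 0 b) := by
  have h1 := h.integrableOn_norm_sq_div_sq hb
  refine (h1.const_mul (b ^ 2)).mono'
    ((h.continuousOn.norm.pow 2).aestronglyMeasurable measurableSet_Ioo) ?_
  filter_upwards [ae_restrict_mem measurableSet_Ioo] with x hx
  have hx0 := hx.1
  rw [Real.norm_of_nonneg (by positivity), ← mul_div_assoc, le_div_iff₀ (by positivity), mul_comm]
  gcongr
  exact hx.2.le

/-- The ground state identity on all of `(0,b)`, when the boundary terms vanish. -/
lemma ground_state_identity_Ioo (h : IsL2Primitive b F g) (hb : 0 < b) {w V : ℝ → ℝ}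
    (hw : ∀ x ∈ Ioo 0 b, HasDerivAt w (-w x ^ 2 - V x) x) (hV : ContinuousOn V (Ioo 0 b))
    (hVF : IntegrableOn (fun x => V x * ‖F x‖ ^ 2) (Ioo 0 b))
    (h0 : Tendsto (fun x => w x * ‖F x‖ ^ 2) (𝓝[>] 0) (𝓝 0))
    (h1 : Tendsto (fun x => w x * ‖F x‖ ^ 2) (𝓝[<] b) (𝓝 0)) :
    IntegrableOn (fun x => ‖g x - w x * F x‖ ^ 2) (Ioo 0 b) ∧
    ∫ x in Ioo 0 b, ‖g x‖ ^ 2 =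
      (∫ x in Ioo 0 b, V x * ‖F x‖ ^ 2) + ∫ x in Ioo 0 b, ‖g x - w x * F x‖ ^ 2 := by
  have hQ := h.integrableOn_sq.sub hVF
  have hlim := (((tendsto_integral_shrink hb hQ).add (h0.comp (tendsto_shrink_left hb))).sub
    (h1.comp (tendsto_shrink_right hb)))
  simp only [Pi.sub_apply, Function.comp, add_zero, sub_zero] at hlim
  have hlim2 : Tendsto (fun n : ℕ => ∫ x in Ioc (b / (n + 3)) (b - b / (n + 3)),
      ‖g x - w x * F x‖ ^ 2 ∂(volume.restrict (Ioo 0 b))) atTop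
      (𝓝 (∫ x in Ioo 0 b, (‖g x‖ ^ 2 - V x * ‖F x‖ ^ 2))) := by
    refine hlim.congr fun n => ?_
    obtain ⟨h1, h2, h3⟩ := shrink_bounds hb n
    rw [restrict_restrict_shrink hb, (h.ground_state_identity hw hV h1 h2 h3).2.2]
  have hi := integrableOn_shrink hb
    (fun a c ha hac hc => (h.ground_state_identity hw hV ha hac hc).1)
  have hnn : 0 ≤ᵐ[volume.restrict (Ioo 0 b)] fun x => ‖g x - w x * F x‖ ^ 2 :=
    ae_nonneg_restrict fun x _ => by positivity
  refine ⟨aecover_Ioo_shrink.integrable_of_integral_tendsto_of_nonneg_ae _ hi hnn hlim2, ?_⟩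
  have := aecover_Ioo_shrink.integral_eq_of_tendsto_of_nonneg_ae _ hnn hi hlim2
  rw [this, integral_sub h.integrableOn_sq hVF]
  ring

end IsL2Primitive

/-! ### The Hardy inequality with the ground state `√x J₀(kx)` -/

/-- The logarithmic derivative `u'/u` of `u(x) = √x J₀(kx)`. -/
noncomputable def besselW (k x : ℝ) : ℝ :=
  (1 / 2 - k * x * besselJ 1 (k * x) / besselJ 0 (k * x)) / x

lemma hasDerivAt_besselJ_zero_mul (k x : ℝ) :
    HasDerivAt (fun x => besselJ 0 (k * x)) (-(k * besselJ 1 (k * x))) x := by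
  have := (hasDerivAt_besselJ_zero (k * x)).comp x ((hasDerivAt_id x).const_mul k)
  convert! this using 1
  ring

lemma hasDerivAt_mul_besselJ_one_mul (k x : ℝ) :
    HasDerivAt (fun x => k * x * besselJ 1 (k * x)) (k ^ 2 * x * besselJ 0 (k * x)) x := by
  have := (hasDerivAt_mul_besselJ_one (k * x)).comp x ((hasDerivAt_id x).const_mul k)
  convert! this using 1
  ring

/-- The Riccati form of Bessel's equation. -/
lemma hasDerivAt_besselW {k x : ℝ} (hx : 0 < x) (h0 : besselJ 0 (k * x) ≠ 0) :
    HasDerivAt (besselW k) (-besselW k x ^ 2 - (1 / (4 * x ^ 2) + k ^ 2)) x := by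
  have h1 := hasDerivAt_besselJ_zero_mul k x
  have h2 := hasDerivAt_mul_besselJ_one_mul k x
  convert! (((h2.div h1 h0).const_sub (1 / 2)).div (hasDerivAt_id x) hx.ne') using 1
  simp only [besselW, id, Pi.div_apply]
  field_simp
  ring

/-- If the square `|g - w F|²` vanishes, then so does `F`: with `u = √x J₀(kx)`, the quotient
`|F|²/u²` is constant, and its limit at `0` is `0` because `|F|² = o(x)`. -/
lemma IsL2Primitive.eq_zero_of_ae_eq_besselW_mul {b k : ℝ} {F g : ℝ → ℂ} (h : IsL2Primitive b F g)
    (hpos : ∀ x ∈ Ioo 0 b, 0 < besselJ 0 (k * x))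
    (hg : ∀ᵐ x ∂(volume.restrict (Ioo 0 b)), g x - besselW k x * F x = 0) :
    ∀ x ∈ Ioo 0 b, F x = 0 := by
  intro c hc
  have hb : 0 < b := hc.1.trans hc.2
  set v : ℝ → ℝ := fun x => 1 / (x * besselJ 0 (k * x) ^ 2) with hv
  have hvd : ∀ x ∈ Ioo 0 b, HasDerivAt v (-2 * besselW k x * v x) x := by
    intro x hx
    have hx0 : x ≠ 0 := hx.1.ne'
    have hp := (hpos x hx).ne'
    have h1 := hasDerivAt_besselJ_zero_mul k x
    convert! (((hasDerivAt_id x).mul (h1.pow 2)).inv (mul_ne_zero hx0 (pow_ne_zero 2 hp))) using 1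
    · ext y; simp [v]
    · simp only [hv, besselW, id, Pi.mul_apply, Pi.pow_apply]
      field_simp
      ring
  have hwc : ContinuousOn (besselW k) (Ioo 0 b) := fun x hx =>
    (hasDerivAt_besselW hx.1 (hpos x hx).ne').continuousAt.continuousWithinAt
  have hvc : ContinuousOn v (Ioo 0 b) := fun x hx => (hvd x hx).continuousAt.continuousWithinAt
  -- `v` is the reciprocal square of the ground state, so `|F|² v` has derivative zero
  have hconst : ∀ a ∈ Ioo 0 c, ‖F c‖ ^ 2 * v c = ‖F a‖ ^ 2 * v a := by
    intro a ha
    have hsub : Icc a c ⊆ Ioo 0 b := fun x hx => ⟨ha.1.trans_le hx.1, hx.2.trans_lt hc.2⟩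
    have hV : IsPrimitiveOn (fun x => (v x : ℂ)) (fun x => ((-2 * besselW k x * v x : ℝ) : ℂ))
        a c := by
      refine IsPrimitiveOn.of_hasDerivAt ha.2.le
        (fun x hx => (hvd x (hsub hx)).ofReal_comp) ?_
      exact (Complex.continuous_ofReal.comp_continuousOn
        ((continuousOn_const.mul hwc).mul hvc)).mono hsub
    have hF := h.isPrimitiveOn ha.1 ha.2.le hc.2
    have e := ((hF.mul hF.conj).mul hV).integral_eq_sub
    rw [intervalIntegral.integral_zero_ae] at e
    · have e2 := (sub_eq_zero.1 e.symm)
      simp only [Complex.mul_conj, Complex.normSq_eq_norm_sq, ← Complex.ofReal_mul] at e2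
      exact_mod_cast e2
    · rw [ae_restrict_iff' measurableSet_Ioo] at hg
      filter_upwards [hg] with x hx hxm
      rw [uIoc_of_le ha.2.le] at hxm
      have := sub_eq_zero.1 (hx (hsub ⟨hxm.1.le, hxm.2⟩))
      rw [this]
      simp only [map_mul, Complex.conj_ofReal, Complex.ofReal_mul]
      push_cast
      ring
  have hlim : Tendsto (fun a => ‖F a‖ ^ 2 * v a) (𝓝[>] 0) (𝓝 0) := by
    have h1 : Tendsto (fun a => 1 / besselJ 0 (k * a) ^ 2) (𝓝[>] 0) (𝓝 1) := by
      have hc0 : Continuous fun a => besselJ 0 (k * a) :=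
        continuous_besselJ_zero.comp (by fun_prop)
      have : ContinuousAt (fun a => 1 / besselJ 0 (k * a) ^ 2) 0 :=
        continuousAt_const.div (hc0.pow 2).continuousAt (by simp [besselJ_zero_zero])
      have h2 := this.tendsto
      simp only [mul_zero, besselJ_zero_zero, one_pow, div_one] at h2
      exact h2.mono_left nhdsWithin_le_nhds
    have := (h.tendsto_norm_sq_div hb).mul h1
    rw [zero_mul] at this
    refine this.congr fun a => ?_
    simp only [hv]
    rw [div_mul_div_comm, mul_one, mul_one_div]
  have hzero : ‖F c‖ ^ 2 * v c = 0 := by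
    refine tendsto_nhds_unique (tendsto_const_nhds.congr' ?_) hlim
    filter_upwards [Ioo_mem_nhdsGT hc.1] with a ha using hconst a ha
  have hvpos : 0 < v c := by
    have h1 := hc.1
    have h2 := hpos c hc
    positivity
  rcases mul_eq_zero.1 hzero with h1 | h1
  · simpa using h1
  · exact absurd h1 hvpos.ne'

/-- The sharp Hardy inequality on `(0,b)` with its equality case, assuming only that the boundary
term of the ground state identity vanishes at `b`. -/
theorem IsL2Primitive.bessel_hardy {b k : ℝ} {F g : ℝ → ℂ} (h : IsL2Primitive b F g) (hb : 0 < b)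
    (hpos : ∀ x ∈ Ioo 0 b, 0 < besselJ 0 (k * x))
    (h1 : Tendsto (fun x => besselW k x * ‖F x‖ ^ 2) (𝓝[<] b) (𝓝 0)) :
    1 / 4 * (∫ x in Ioo 0 b, ‖F x‖ ^ 2 / x ^ 2) + k ^ 2 * (∫ x in Ioo 0 b, ‖F x‖ ^ 2) ≤
        ∫ x in Ioo 0 b, ‖g x‖ ^ 2 ∧
    (1 / 4 * (∫ x in Ioo 0 b, ‖F x‖ ^ 2 / x ^ 2) + k ^ 2 * (∫ x in Ioo 0 b, ‖F x‖ ^ 2) =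
        ∫ x in Ioo 0 b, ‖g x‖ ^ 2 → ∀ x ∈ Ioo 0 b, F x = 0) := by
  have i1 := h.integrableOn_norm_sq_div_sq hb
  have i2 := h.integrableOn_norm_sq hb
  have eV : ∀ x, (1 / (4 * x ^ 2) + k ^ 2) * ‖F x‖ ^ 2 =
      1 / 4 * (‖F x‖ ^ 2 / x ^ 2) + k ^ 2 * ‖F x‖ ^ 2 := fun x => by ring
  have h0 : Tendsto (fun x => besselW k x * ‖F x‖ ^ 2) (𝓝[>] 0) (𝓝 0) := by
    have hc : ContinuousAt
        (fun x => 1 / 2 - k * x * besselJ 1 (k * x) / besselJ 0 (k * x)) 0 := by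
      have c0 : Continuous fun a => besselJ 0 (k * a) :=
        continuous_besselJ_zero.comp (by fun_prop)
      have c1 : Continuous fun a => k * a * besselJ 1 (k * a) :=
        (by fun_prop : Continuous fun a : ℝ => k * a).mul
          (continuous_besselJ_one.comp (by fun_prop))
      exact continuousAt_const.sub
        (c1.continuousAt.div c0.continuousAt (by simp [besselJ_zero_zero]))
    have := (hc.tendsto.mono_left nhdsWithin_le_nhds).mul (h.tendsto_norm_sq_div hb)
    rw [mul_zero] at this
    refine this.congr fun x => ?_
    rw [besselW]
    ring
  have hV : ContinuousOn (fun x : ℝ => 1 / (4 * x ^ 2) + k ^ 2) (Ioo 0 b) := by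
    refine (continuousOn_const.div (by fun_prop) fun x hx => ?_).add continuousOn_const
    have := hx.1
    positivity
  have iV : IntegrableOn (fun x => (1 / (4 * x ^ 2) + k ^ 2) * ‖F x‖ ^ 2) (Ioo 0 b) := by
    simp_rw [eV]
    exact (i1.const_mul _).add (i2.const_mul _)
  obtain ⟨iR, e⟩ := h.ground_state_identity_Ioo hb
    (fun x hx => hasDerivAt_besselW hx.1 (hpos x hx).ne') hV iV h0 h1
  simp_rw [eV] at e
  rw [integral_add (i1.const_mul _) (i2.const_mul _), integral_const_mul, integral_const_mul] at e
  have hR : 0 ≤ ∫ x in Ioo 0 b, ‖g x - besselW k x * F x‖ ^ 2 :=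
    integral_nonneg fun x => by positivity
  refine ⟨by linarith, fun heq => h.eq_zero_of_ae_eq_besselW_mul hpos ?_⟩
  have hR0 : ∫ x in Ioo 0 b, ‖g x - besselW k x * F x‖ ^ 2 = 0 := by linarith
  rw [integral_eq_zero_iff_of_nonneg (fun x => by positivity) iR] at hR0
  filter_upwards [hR0] with x hx
  simpa using hx

/-- At an endpoint where the ground state satisfies the Neumann condition, the boundary term
vanishes. -/
lemma IsL2Primitive.tendsto_besselW_neumann {b k : ℝ} {F g : ℝ → ℂ} (h : IsL2Primitive b F g)
    (hb : 0 < b) (hpos : 0 < besselJ 0 (k * b))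
    (hN : besselJ 0 (k * b) - 2 * (k * b) * besselJ 1 (k * b) = 0) :
    Tendsto (fun x => besselW k x * ‖F x‖ ^ 2) (𝓝[<] b) (𝓝 0) := by
  have hw : besselW k b = 0 := by
    have : k * b * besselJ 1 (k * b) / besselJ 0 (k * b) = 1 / 2 := by
      rw [div_eq_iff hpos.ne']; linarith
    rw [besselW, this]
    simp
  have h1 := ((hasDerivAt_besselW hb hpos.ne').continuousAt.tendsto.mono_left
    (nhdsWithin_le_nhds (s := Iio b))).mul ((h.tendsto_left hb).norm.pow 2)
  rwa [hw, zero_mul] at h1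

/-- At an endpoint where the ground state and the function both vanish, the boundary term
vanishes: `u'/u` is of order `1/(b - x)` while `|F|²` is `o(b - x)`. -/
lemma IsL2Primitive.tendsto_besselW_dirichlet {b k : ℝ} {F g : ℝ → ℂ} (h : IsL2Primitive b F g)
    (hb : 0 < b) (hF : ∫ t in (0 : ℝ)..b, g t = 0) (hk : k ≠ 0) (h0 : besselJ 0 (k * b) = 0)
    (h1 : besselJ 1 (k * b) ≠ 0) :
    Tendsto (fun x => besselW k x * ‖F x‖ ^ 2) (𝓝[<] b) (𝓝 0) := by
  have hF' : Tendsto (fun x => ‖F x‖ ^ 2 / (b - x)) (𝓝[<] b) (𝓝 0) := by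
    have hs : Tendsto (fun x => b - x) (𝓝[<] b) (𝓝[>] 0) := by
      refine tendsto_nhdsWithin_iff.2 ⟨?_, ?_⟩
      · have : Tendsto (fun x => b - x) (𝓝 b) (𝓝 (b - b)) := by
          exact (by fun_prop : Continuous fun x : ℝ => b - x).tendsto b
        rw [sub_self] at this
        exact this.mono_left nhdsWithin_le_nhds
      · filter_upwards [self_mem_nhdsWithin] with x hx
        exact sub_pos.2 (mem_Iio.1 hx)
    have := ((h.reflect hb hF).tendsto_norm_sq_div hb).comp hs
    simpa [Function.comp_def] using this
  have hslope := (hasDerivAt_iff_tendsto_slope.1 (hasDerivAt_besselJ_zero_mul k b)).mono_left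
    (nhdsWithin_mono b (show Iio b ⊆ {b}ᶜ from fun x hx => (ne_of_lt hx)))
  have hinv := hslope.inv₀ (neg_ne_zero.2 (mul_ne_zero hk h1))
  have c1 : Continuous fun x => k * besselJ 1 (k * x) :=
    continuous_const.mul (continuous_besselJ_one.comp (by fun_prop))
  have hA : Tendsto (fun x => (b - x) / (2 * x) + k * besselJ 1 (k * x) *
      (slope (fun x => besselJ 0 (k * x)) b x)⁻¹) (𝓝[<] b)
      (𝓝 ((b - b) / (2 * b) + k * besselJ 1 (k * b) * (-(k * besselJ 1 (k * b)))⁻¹)) := by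
    refine Tendsto.add (Tendsto.mono_left ?_ nhdsWithin_le_nhds)
      ((c1.tendsto b).mono_left nhdsWithin_le_nhds |>.mul hinv)
    exact ((by fun_prop : Continuous fun x : ℝ => b - x).tendsto b).div
      ((by fun_prop : Continuous fun x : ℝ => 2 * x).tendsto b) (by positivity)
  have := hA.mul hF'
  rw [mul_zero] at this
  refine this.congr' ?_
  filter_upwards [Ioo_mem_nhdsLT hb] with x hx
  have hx1 : b - x ≠ 0 := (sub_pos.2 hx.2).ne'
  have hx2 : x ≠ 0 := hx.1.ne'
  have hx3 : x - b ≠ 0 := (sub_neg.2 hx.2).ne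
  rw [slope_def_field, h0, sub_zero, besselW, inv_div]
  have e : x - b = -(b - x) := by ring
  rw [e, neg_div, mul_neg, mul_div_assoc' (k * besselJ 1 (k * x))]
  field_simp
  ring

/-! ### Test functions and weak derivatives -/

section TestFunctions

variable {Ω : Set ℝ} {φ ψ f g g₁ g₂ : ℝ → ℂ} {b : ℝ}

lemma testFunctions_deriv (hφ : φ ∈ testFunctions Ω) : deriv φ ∈ testFunctions Ω :=
  ⟨(contDiff_infty_iff_deriv.1 hφ.1).2, hφ.2.1.deriv,
    (closure_minimal support_deriv_subset (isClosed_tsupport φ)).trans hφ.2.2⟩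

lemma testFunctions_hasDerivAt (hφ : φ ∈ testFunctions Ω) (x : ℝ) :
    HasDerivAt φ (deriv φ x) x :=
  ((contDiff_infty_iff_deriv.1 hφ.1).1 x).hasDerivAt

lemma testFunctions_continuous_deriv (hφ : φ ∈ testFunctions Ω) : Continuous (deriv φ) :=
  (testFunctions_deriv hφ).1.continuous

lemma testFunctions_eq_zero (hφ : φ ∈ testFunctions Ω) {x : ℝ} (hx : x ∉ Ω) : φ x = 0 := by
  by_contra h
  exact hx (hφ.2.2 (subset_tsupport φ h))

lemma testFunctions_sub (hφ : φ ∈ testFunctions Ω) (hψ : ψ ∈ testFunctions Ω) :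
    φ - ψ ∈ testFunctions Ω := by
  refine ⟨hφ.1.sub hψ.1, hφ.2.1.sub hψ.2.1, ?_⟩
  exact (tsupport_sub φ ψ).trans (union_subset hφ.2.2 hψ.2.2)

lemma testFunctions_add (hφ : φ ∈ testFunctions Ω) (hψ : ψ ∈ testFunctions Ω) :
    φ + ψ ∈ testFunctions Ω := by
  refine ⟨hφ.1.add hψ.1, hφ.2.1.add hψ.2.1, ?_⟩
  exact (tsupport_add φ ψ).trans (union_subset hφ.2.2 hψ.2.2)

lemma testFunctions_const_smul (c : ℂ) (hφ : φ ∈ testFunctions Ω) :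
    c • φ ∈ testFunctions Ω := by
  have hs : Function.support (c • φ) ⊆ Function.support φ := Function.support_const_smul_subset c φ
  exact ⟨contDiff_const.smul hφ.1, hφ.2.1.mono hs, (closure_mono hs).trans hφ.2.2⟩

lemma testFunctions_conj (hφ : φ ∈ testFunctions Ω) :
    (fun x => (starRingEnd ℂ) (φ x)) ∈ testFunctions Ω := by
  have hs : Function.support (fun x => (starRingEnd ℂ) (φ x)) ⊆ Function.support φ := by
    intro x hx h0
    exact hx (by simp [h0])
  exact ⟨Complex.conjCLE.contDiff.comp hφ.1, hφ.2.1.mono hs, (closure_mono hs).trans hφ.2.2⟩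

lemma testFunctions_ofReal {η : ℝ → ℝ} (h1 : ContDiff ℝ ∞ η) (h2 : HasCompactSupport η)
    (h3 : tsupport η ⊆ Ω) : (fun x => (η x : ℂ)) ∈ testFunctions Ω := by
  have hs : Function.support (fun x => (η x : ℂ)) ⊆ Function.support η := by
    intro x hx h0
    exact hx (by simp [h0])
  exact ⟨Complex.ofRealCLM.contDiff.comp h1, h2.mono hs, (closure_mono hs).trans h3⟩

lemma integrable_testFunctions_mul (hφ : φ ∈ testFunctions Ω) (hf : LocallyIntegrableOn f Ω) :
    Integrable (fun x => φ x * f x) := by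
  have h1 : IntegrableOn (fun x => φ x * f x) (tsupport φ) :=
    IntegrableOn.continuousOn_mul hφ.1.continuous.continuousOn
      (hf.integrableOn_compact_subset hφ.2.2 hφ.2.1) hφ.2.1
  refine (integrableOn_iff_integrable_of_support_subset ?_).1 h1
  intro x hx
  exact subset_tsupport φ (fun h0 => hx (by simp [h0]))

lemma setIntegral_testFunctions_mul (hφ : φ ∈ testFunctions Ω) :
    ∫ x in Ω, φ x * f x = ∫ x, φ x * f x :=
  setIntegral_eq_integral_of_forall_compl_eq_zero fun x hx => by
    rw [testFunctions_eq_zero hφ hx, zero_mul]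

/-- The fundamental lemma of the calculus of variations, for complex test functions. -/
lemma ae_eq_of_forall_testFunctions (hΩ : IsOpen Ω) (h₁ : LocallyIntegrableOn g₁ Ω)
    (h₂ : LocallyIntegrableOn g₂ Ω)
    (h : ∀ φ ∈ testFunctions Ω, ∫ x in Ω, φ x * g₁ x = ∫ x in Ω, φ x * g₂ x) :
    g₁ =ᵐ[volume.restrict Ω] g₂ := by
  have key := hΩ.ae_eq_zero_of_integral_contDiff_smul_eq_zero (μ := volume) (h₁.sub h₂) ?_
  · rw [EventuallyEq, ae_restrict_iff' hΩ.measurableSet]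
    filter_upwards [key] with x hx hxΩ
    exact sub_eq_zero.1 (hx hxΩ)
  · intro η h1 h2 h3
    have hη := testFunctions_ofReal h1 h2 h3
    have e := h _ hη
    rw [setIntegral_testFunctions_mul hη, setIntegral_testFunctions_mul hη, ← sub_eq_zero,
      ← integral_sub (integrable_testFunctions_mul hη h₁)
        (integrable_testFunctions_mul hη h₂)] at e
    rw [← e]
    refine integral_congr_ae (Eventually.of_forall fun x => ?_)
    simp only [Pi.sub_apply, Complex.real_smul]
    ring

lemma HasWeakDeriv.ae_unique (hΩ : IsOpen Ω) (h₁ : HasWeakDeriv Ω f g₁)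
    (h₂ : HasWeakDeriv Ω f g₂) : g₁ =ᵐ[volume.restrict Ω] g₂ :=
  ae_eq_of_forall_testFunctions hΩ h₁.2.1 h₂.2.1 fun φ hφ =>
    neg_injective ((h₁.2.2 φ hφ).symm.trans (h₂.2.2 φ hφ))

/-- A test function on `(0,b)` vanishes outside a compact subinterval. -/
lemma exists_support_subset_Ioo (hb : 0 < b) (hφ : φ ∈ testFunctions (Ioo 0 b)) :
    ∃ a c, 0 < a ∧ a < c ∧ c < b ∧ tsupport φ ⊆ Ioo a c := by
  have hK : IsCompact (insert (b / 2) (tsupport φ)) := hφ.2.1.isCompact.insert _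
  have hKs : insert (b / 2) (tsupport φ) ⊆ Ioo 0 b :=
    insert_subset ⟨by linarith, by linarith⟩ hφ.2.2
  obtain ⟨m, hm, hm'⟩ := hK.exists_isLeast (insert_nonempty _ _)
  obtain ⟨M, hM, hM'⟩ := hK.exists_isGreatest (insert_nonempty _ _)
  have h1 := hKs hm
  have h2 := hKs hM
  have h3 := hm' hM
  refine ⟨m / 2, (M + b) / 2, by linarith [h1.1], by linarith [h1.1, h2.2],
    by linarith [h2.2], fun x hx => ⟨?_, ?_⟩⟩
  · linarith [hm' (mem_insert_of_mem _ hx), h1.1]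
  · linarith [hM' (mem_insert_of_mem _ hx), h2.2]

lemma intervalIntegral_eq_integral_of_support {h : ℝ → ℂ} {a c : ℝ} (hac : a ≤ c)
    (hs : ∀ x ∉ Ioo a c, h x = 0) : ∫ x in a..c, h x = ∫ x, h x := by
  rw [intervalIntegral.integral_of_le hac]
  exact setIntegral_eq_integral_of_forall_compl_eq_zero fun x hx =>
    hs x fun hx' => hx (Ioo_subset_Ioc_self hx')

/-- A test function of zero mean on `(0,b)` is the derivative of a test function. -/
lemma exists_testFunctions_deriv_eq (hb : 0 < b) (hψ : ψ ∈ testFunctions (Ioo 0 b))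
    (h0 : ∫ x, ψ x = 0) : ∃ φ ∈ testFunctions (Ioo 0 b), deriv φ = ψ := by
  obtain ⟨a, c, ha, hac, hc, hs⟩ := exists_support_subset_Ioo hb hψ
  have hz : ∀ x ∉ Ioo a c, ψ x = 0 := fun x hx => by
    by_contra h
    exact hx (hs (subset_tsupport ψ h))
  have hcont := hψ.1.continuous
  have hd : ∀ x, HasDerivAt (fun x => ∫ t in a..x, ψ t) (ψ x) x := fun x =>
    (hcont.integral_hasStrictDerivAt a x).hasDerivAt
  have hderiv : deriv (fun x => ∫ t in a..x, ψ t) = ψ := funext fun x => (hd x).deriv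
  have hI : ∫ t in a..c, ψ t = 0 := by
    rw [intervalIntegral_eq_integral_of_support hac.le hz, h0]
  have hsupp : Function.support (fun x => ∫ t in a..x, ψ t) ⊆ Icc a c := by
    intro x hx
    by_contra hxm
    apply hx
    rcases lt_or_ge x a with h | h
    · refine intervalIntegral.integral_zero_ae (Eventually.of_forall fun t ht => hz t ?_)
      rw [uIoc_of_ge h.le] at ht
      exact fun h' => absurd ht.2 (not_le.2 h'.1)
    · have hcx : c < x := by
        by_contra! hxc
        exact hxm ⟨h, hxc⟩
      change ∫ t in a..x, ψ t = 0
      rw [← intervalIntegral.integral_add_adjacent_intervals (hcont.intervalIntegrable a c)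
        (hcont.intervalIntegrable c x), hI, zero_add]
      refine intervalIntegral.integral_zero_ae (Eventually.of_forall fun t ht => hz t ?_)
      rw [uIoc_of_le hcx.le] at ht
      exact fun h' => absurd h'.2 (not_lt.2 ht.1.le)
  have hts : tsupport (fun x => ∫ t in a..x, ψ t) ⊆ Icc a c :=
    closure_minimal hsupp isClosed_Icc
  refine ⟨_, ⟨?_, ?_, ?_⟩, hderiv⟩
  · rw [contDiff_infty_iff_deriv, hderiv]
    exact ⟨fun x => (hd x).differentiableAt, hψ.1⟩
  · exact isCompact_Icc.of_isClosed_subset (isClosed_tsupport _) hts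
  · exact hts.trans fun x hx => ⟨ha.trans_le hx.1, hx.2.trans_lt hc⟩

lemma exists_testFunctions_integral_eq_one (hb : 0 < b) :
    ∃ η ∈ testFunctions (Ioo 0 b), ∫ x, η x = 1 := by
  let B : ContDiffBump (b / 2) := ⟨b / 8, b / 4, by linarith, by linarith⟩
  refine ⟨fun x => (B.normed volume x : ℂ),
    testFunctions_ofReal B.contDiff_normed B.hasCompactSupport_normed ?_, ?_⟩
  · rw [B.tsupport_normed_eq, Real.closedBall_eq_Icc]
    intro x hx
    have h1 : b / 2 - b / 4 ≤ x := hx.1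
    have h2 : x ≤ b / 2 + b / 4 := hx.2
    exact ⟨by linarith, by linarith⟩
  · rw [integral_complex_ofReal, B.integral_normed, Complex.ofReal_one]

/-- The lemma of du Bois-Reymond: a function whose weak derivative vanishes is constant. -/
lemma HasWeakDeriv.ae_eq_const (hb : 0 < b) (h : HasWeakDeriv (Ioo 0 b) f 0) :
    ∃ C : ℂ, f =ᵐ[volume.restrict (Ioo 0 b)] fun _ => C := by
  obtain ⟨η, hη, hη1⟩ := exists_testFunctions_integral_eq_one hb
  refine ⟨∫ x, η x * f x, ?_⟩
  set C := ∫ x, η x * f x with hC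
  refine ae_eq_of_forall_testFunctions isOpen_Ioo h.1
    (continuous_const.locallyIntegrable.locallyIntegrableOn _) fun ψ hψ => ?_
  have iψ : Integrable ψ := hψ.1.continuous.integrable_of_hasCompactSupport hψ.2.1
  have iη : Integrable η := hη.1.continuous.integrable_of_hasCompactSupport hη.2.1
  have hψ' := testFunctions_sub hψ (testFunctions_const_smul (∫ x, ψ x) hη)
  obtain ⟨φ, hφ, hφd⟩ := exists_testFunctions_deriv_eq hb hψ' (by
    simp only [Pi.sub_apply, Pi.smul_apply, smul_eq_mul]
    rw [integral_sub iψ (iη.const_mul _), integral_const_mul, hη1, mul_one, sub_self])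
  have e := h.2.2 φ hφ
  simp only [Pi.zero_apply, mul_zero, integral_zero, neg_zero] at e
  rw [hφd, setIntegral_testFunctions_mul hψ'] at e
  have e2 : ∀ x, (ψ - (∫ x, ψ x) • η) x * f x = ψ x * f x - (∫ x, ψ x) * (η x * f x) := by
    intro x
    simp only [Pi.sub_apply, Pi.smul_apply, smul_eq_mul]
    ring
  simp_rw [e2] at e
  rw [integral_sub (integrable_testFunctions_mul hψ h.1)
    ((integrable_testFunctions_mul hη h.1).const_mul _), integral_const_mul, sub_eq_zero] at e
  rw [setIntegral_testFunctions_mul hψ, setIntegral_testFunctions_mul hψ, e, integral_mul_const]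

lemma HasWeakDeriv.sub (h₁ : HasWeakDeriv Ω f g₁) {f₂ : ℝ → ℂ} (h₂ : HasWeakDeriv Ω f₂ g₂) :
    HasWeakDeriv Ω (f - f₂) (g₁ - g₂) := by
  refine ⟨h₁.1.sub h₂.1, h₁.2.1.sub h₂.2.1, fun φ hφ => ?_⟩
  have hd := testFunctions_deriv hφ
  rw [setIntegral_testFunctions_mul hd, setIntegral_testFunctions_mul hφ]
  have e1 := h₁.2.2 φ hφ
  have e2 := h₂.2.2 φ hφ
  rw [setIntegral_testFunctions_mul hd, setIntegral_testFunctions_mul hφ] at e1 e2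
  simp only [Pi.sub_apply, mul_sub]
  rw [integral_sub (integrable_testFunctions_mul hd h₁.1) (integrable_testFunctions_mul hd h₂.1),
    integral_sub (integrable_testFunctions_mul hφ h₁.2.1)
      (integrable_testFunctions_mul hφ h₂.2.1), e1, e2]
  ring

/-- The primitive of a square integrable function has that function as its weak derivative. -/
lemma IsL2Primitive.hasWeakDeriv (hb : 0 < b) (h : IsL2Primitive b f g) :
    HasWeakDeriv (Ioo 0 b) f g := by
  refine ⟨h.continuousOn.locallyIntegrableOn measurableSet_Ioo,
    IntegrableOn.locallyIntegrableOn (h.memLp.integrable (by norm_num)), fun φ hφ => ?_⟩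
  have hf : LocallyIntegrableOn f (Ioo 0 b) := h.continuousOn.locallyIntegrableOn measurableSet_Ioo
  have hg : LocallyIntegrableOn g (Ioo 0 b) :=
    IntegrableOn.locallyIntegrableOn (h.memLp.integrable (by norm_num))
  obtain ⟨a, c, ha, hac, hc, hs⟩ := exists_support_subset_Ioo hb hφ
  have hz : ∀ x ∉ Ioo a c, φ x = 0 := fun x hx => by
    by_contra h
    exact hx (hs (subset_tsupport φ h))
  have hz' : ∀ x ∉ Ioo a c, deriv φ x = 0 := fun x hx => by
    by_contra h
    exact hx (hs (support_deriv_subset h))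
  have hd := testFunctions_deriv hφ
  have hφp : IsPrimitiveOn φ (deriv φ) a c := IsPrimitiveOn.of_hasDerivAt hac.le
    (fun x _ => testFunctions_hasDerivAt hφ x) (testFunctions_continuous_deriv hφ).continuousOn
  have e := (hφp.mul (h.isPrimitiveOn ha hac.le hc)).integral_eq_sub
  rw [hz a (by simp), hz c (by simp), zero_mul, zero_mul, sub_zero,
    intervalIntegral_eq_integral_of_support hac.le
      (fun x hx => by rw [hz x hx, hz' x hx, zero_mul, zero_mul, add_zero]),
    integral_add (integrable_testFunctions_mul hd hf) (integrable_testFunctions_mul hφ hg)] at e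
  rw [setIntegral_testFunctions_mul hd, setIntegral_testFunctions_mul hφ]
  exact eq_neg_of_add_eq_zero_left e

end TestFunctions

/-! ### Sobolev functions as primitives -/

section Sobolev

variable {f g φ : ℝ → ℂ} {b : ℝ}

lemma integral_sq_lt_of_eLpNorm_lt {h : ℝ → ℂ} {μ : Measure ℝ} (hh : MemLp h 2 μ) {ε : ℝ}
    (hε : 0 < ε) (hlt : eLpNorm h 2 μ < ENNReal.ofReal ε) : ∫ x, ‖h x‖ ^ 2 ∂μ < ε ^ 2 := by
  rw [hh.eLpNorm_eq_integral_rpow_norm (by norm_num) (by norm_num),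
    ENNReal.ofReal_lt_ofReal_iff hε] at hlt
  simp only [ENNReal.toReal_ofNat, Real.rpow_ofNat] at hlt
  have h0 : 0 ≤ ∫ x, ‖h x‖ ^ 2 ∂μ := integral_nonneg fun x => by positivity
  rw [show (2 : ℝ)⁻¹ = 1 / 2 by norm_num, ← Real.sqrt_eq_rpow] at hlt
  exact (Real.sqrt_lt' hε).1 hlt

/-- The primitive vanishing at `0` of an `L²`-small function is `L²`-small. -/
lemma IsL2Primitive.eLpNorm_le (h : IsL2Primitive b f g) (hb : 0 < b) {ε : ℝ} (hε : 0 < ε)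
    (hlt : eLpNorm g 2 (volume.restrict (Ioo 0 b)) < ENNReal.ofReal ε) :
    eLpNorm f 2 (volume.restrict (Ioo 0 b)) ≤ ENNReal.ofReal (b * ε) := by
  have hI := integral_sq_lt_of_eLpNorm_lt h.memLp hε hlt
  have hbd : ∀ᵐ x ∂(volume.restrict (Ioo 0 b)), ‖f x‖ ≤ √b * ε := by
    filter_upwards [ae_restrict_mem measurableSet_Ioo] with x hx
    have h1 := h.norm_sq_le hx
    have h2 : ∫ t in (0 : ℝ)..x, ‖g t‖ ^ 2 ≤ ∫ t in (0 : ℝ)..b, ‖g t‖ ^ 2 :=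
      intervalIntegral.integral_mono_interval le_rfl hx.1.le hx.2.le
        (Eventually.of_forall fun x => by positivity) (h.intervalIntegrable_sq hb.le)
    rw [intervalIntegral.integral_of_le hb.le, integral_Ioc_eq_integral_Ioo] at h2
    have h3 : ‖f x‖ ^ 2 ≤ (√b * ε) ^ 2 := by
      rw [mul_pow, Real.sq_sqrt hb.le]
      refine h1.trans (mul_le_mul hx.2.le (h2.trans hI.le) ?_ hb.le)
      exact intervalIntegral.integral_nonneg hx.1.le fun x _ => by positivity
    exact le_of_sq_le_sq h3 (by positivity)
  refine (eLpNorm_le_of_ae_bound hbd).trans (le_of_eq ?_)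
  rw [Measure.restrict_apply_univ, Real.volume_Ioo, sub_zero, ENNReal.ofReal_rpow_of_pos hb,
    ← ENNReal.ofReal_mul (by positivity)]
  congr 1
  simp only [ENNReal.toReal_ofNat]
  rw [show (2 : ℝ)⁻¹ = 1 / 2 by norm_num, ← Real.sqrt_eq_rpow, ← mul_assoc,
    Real.mul_self_sqrt hb.le]

lemma testFunctions_memLp {Ω : Set ℝ} (hφ : φ ∈ testFunctions Ω) :
    MemLp φ 2 (volume.restrict Ω) :=
  (hφ.1.continuous.memLp_of_hasCompactSupport hφ.2.1).restrict _

lemma testFunctions_eq_integral (hφ : φ ∈ testFunctions (Ioo 0 b)) (x : ℝ) :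
    φ x = ∫ t in (0 : ℝ)..x, deriv φ t := by
  rw [intervalIntegral.integral_eq_sub_of_hasDerivAt (fun y _ => testFunctions_hasDerivAt hφ y)
    ((testFunctions_continuous_deriv hφ).intervalIntegrable _ _),
    testFunctions_eq_zero (x := 0) hφ (by simp), sub_zero]

lemma IsL2Primitive.sub_testFunctions (h : IsL2Primitive b f g)
    (hφ : φ ∈ testFunctions (Ioo 0 b)) : IsL2Primitive b (f - φ) (g - deriv φ) := by
  refine ⟨h.memLp.sub (testFunctions_memLp (testFunctions_deriv hφ)), fun x hx => ?_⟩
  have hb : 0 ≤ b := (hx.1.trans hx.2).le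
  have hi : IntervalIntegrable g volume 0 x := (h.intervalIntegrable hb).mono_set (by
    rw [uIcc_of_le hx.1.le, uIcc_of_le hb]; exact Icc_subset_Icc_right hx.2.le)
  simp only [Pi.sub_apply]
  rw [intervalIntegral.integral_sub hi
    ((testFunctions_continuous_deriv hφ).intervalIntegrable _ _), ← h.eq_integral x hx,
    ← testFunctions_eq_integral hφ]

lemma IsL2Primitive.norm_integral_le (h : IsL2Primitive b f g) (hb : 0 < b) {ε : ℝ} (hε : 0 < ε)
    (hlt : eLpNorm g 2 (volume.restrict (Ioo 0 b)) < ENNReal.ofReal ε) :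
    ‖∫ t in (0 : ℝ)..b, g t‖ ≤ √b * ε := by
  have hI := integral_sq_lt_of_eLpNorm_lt h.memLp hε hlt
  have h1 := norm_integral_sq_le hb.le (h.intervalIntegrable hb.le) (h.intervalIntegrable_sq hb.le)
  rw [intervalIntegral.integral_of_le hb.le (f := fun t => ‖g t‖ ^ 2),
    integral_Ioc_eq_integral_Ioo, sub_zero] at h1
  refine le_of_sq_le_sq (h1.trans ?_) (by positivity)
  rw [mul_pow, Real.sq_sqrt hb.le]
  exact mul_le_mul_of_nonneg_left hI.le hb.le

/-- A function in `H¹₀((0,b))` agrees almost everywhere with the primitive of its derivative that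
vanishes at both endpoints. -/
lemma exists_isL2Primitive_of_mem_sobolevH10 (hb : 0 < b) (hf : f ∈ sobolevH10 (Ioo 0 b)) :
    ∃ F g, f =ᵐ[volume.restrict (Ioo 0 b)] F ∧ IsL2Primitive b F g ∧
      ∫ t in (0 : ℝ)..b, g t = 0 ∧ HasWeakDeriv (Ioo 0 b) f g := by
  obtain ⟨hf2, g, hfg, hg2, happ⟩ := hf
  set F : ℝ → ℂ := fun x => ∫ t in (0 : ℝ)..x, g t with hF
  have hP : IsL2Primitive b F g := ⟨hg2, fun x _ => rfl⟩
  have hFm : AEStronglyMeasurable F (volume.restrict (Ioo 0 b)) :=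
    hP.continuousOn.aestronglyMeasurable measurableSet_Ioo
  refine ⟨F, g, ?_, hP, ?_, hfg⟩
  · have hzero : eLpNorm (f - F) 2 (volume.restrict (Ioo 0 b)) = 0 := by
      refine le_antisymm (ENNReal.le_of_forall_pos_le_add fun ε hε _ => ?_) zero_le
      have hδ : 0 < (ε : ℝ) / (1 + b) := by positivity
      obtain ⟨φ, hφ, h1, h2⟩ := happ (ENNReal.ofReal ((ε : ℝ) / (1 + b))) (by simpa using hδ)
      have hD := (hP.sub_testFunctions hφ).eLpNorm_le hb hδ h2
      have e : f - F = (f - φ) - (F - φ) := by ext x; simp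
      rw [e, zero_add]
      have hφm := hφ.1.continuous.aestronglyMeasurable (μ := volume.restrict (Ioo 0 b))
      refine (eLpNorm_sub_le (hf2.1.sub hφm) (hFm.sub hφm) (by norm_num)).trans
        ((add_le_add h1.le hD).trans (le_of_eq ?_))
      rw [← ENNReal.ofReal_add hδ.le (by positivity),
        show (ε : ℝ) / (1 + b) + b * (ε / (1 + b)) = ε by field_simp]
      exact ENNReal.ofReal_coe_nnreal
    rw [eLpNorm_eq_zero_iff (hf2.1.sub hFm) (by norm_num)] at hzero
    filter_upwards [hzero] with x hx
    exact sub_eq_zero.1 hx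
  · refine norm_le_zero_iff.1 (le_of_forall_pos_le_add fun ε hε => ?_)
    have hδ : 0 < ε / √b := by positivity
    obtain ⟨φ, hφ, -, h2⟩ := happ (ENNReal.ofReal (ε / √b)) (by simpa using hδ)
    have h3 := (hP.sub_testFunctions hφ).norm_integral_le hb hδ h2
    simp only [Pi.sub_apply] at h3
    rw [intervalIntegral.integral_sub (hP.intervalIntegrable hb.le)
      ((testFunctions_continuous_deriv hφ).intervalIntegrable _ _),
      ← testFunctions_eq_integral hφ, testFunctions_eq_zero (x := b) hφ (by simp), sub_zero] at h3
    have h4 : √b * (ε / √b) = ε := by field_simp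
    linarith

/-- The derivatives of test functions on `(0,b)`, as a subspace of `L²((0,b))`. -/
noncomputable def testDerivSubmodule (b : ℝ) :
    Submodule ℂ (Lp ℂ 2 (volume.restrict (Ioo 0 b))) where
  carrier := {u | ∃ φ ∈ testFunctions (Ioo 0 b), u =ᵐ[volume.restrict (Ioo 0 b)] deriv φ}
  add_mem' := by
    rintro u v ⟨φ, hφ, hu⟩ ⟨ψ, hψ, hv⟩
    refine ⟨φ + ψ, testFunctions_add hφ hψ, ?_⟩
    filter_upwards [Lp.coeFn_add u v, hu, hv] with x h1 h2 h3
    rw [h1, Pi.add_apply, h2, h3,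
      ((testFunctions_hasDerivAt hφ x).add (testFunctions_hasDerivAt hψ x)).deriv]
  zero_mem' := by
    refine ⟨0, ⟨contDiff_const, HasCompactSupport.zero, by simp⟩, ?_⟩
    filter_upwards [Lp.coeFn_zero ℂ 2 (volume.restrict (Ioo 0 b))] with x hx
    rw [hx]
    simp
  smul_mem' := by
    rintro c u ⟨φ, hφ, hu⟩
    refine ⟨c • φ, testFunctions_const_smul c hφ, ?_⟩
    filter_upwards [Lp.coeFn_smul c u, hu] with x h1 h2
    rw [h1, Pi.smul_apply, h2, ((testFunctions_hasDerivAt hφ x).const_smul c).deriv]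

/-- By the lemma of du Bois-Reymond, the orthogonal complement of the derivatives of test
functions consists of constants. -/
lemma ae_eq_const_of_mem_orthogonal_testDeriv (hb : 0 < b)
    {v : Lp ℂ 2 (volume.restrict (Ioo 0 b))} (hv : v ∈ (testDerivSubmodule b)ᗮ) :
    ∃ C : ℂ, v =ᵐ[volume.restrict (Ioo 0 b)] fun _ => C := by
  have hloc : LocallyIntegrableOn (v : ℝ → ℂ) (Ioo 0 b) :=
    IntegrableOn.locallyIntegrableOn ((Lp.memLp v).integrable (by norm_num))
  refine HasWeakDeriv.ae_eq_const hb ⟨hloc,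
    continuous_zero.locallyIntegrable.locallyIntegrableOn _, fun φ hφ => ?_⟩
  simp only [Pi.zero_apply, mul_zero, integral_zero, neg_zero]
  have hφ' := testFunctions_conj hφ
  have hm := testFunctions_memLp (testFunctions_deriv hφ')
  have h0 := (Submodule.mem_orthogonal _ v).1 hv (hm.toLp _) ⟨_, hφ', hm.coeFn_toLp⟩
  rw [L2.inner_def] at h0
  rw [← h0]
  refine integral_congr_ae ?_
  filter_upwards [hm.coeFn_toLp] with x hx
  have hd : HasDerivAt (fun x => (starRingEnd ℂ) (φ x)) ((starRingEnd ℂ) (deriv φ x)) x :=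
    by
    have := Complex.conjCLE.toContinuousLinearMap.hasFDerivAt.comp_hasDerivAt x
      (testFunctions_hasDerivAt hφ x)
    exact this
  rw [hx, hd.deriv, RCLike.inner_apply, RCLike.conj_conj, mul_comm]

/-- The primitive, vanishing at both endpoints, of a square integrable function belongs to
`H¹₀((0,b))`. Its derivative is orthogonal to the constants, hence a limit in `L²` of derivatives
of test functions. -/
lemma IsL2Primitive.mem_sobolevH10 (h : IsL2Primitive b f g) (hb : 0 < b)
    (h0 : ∫ t in (0 : ℝ)..b, g t = 0) : f ∈ sobolevH10 (Ioo 0 b) := by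
  have hfm : AEStronglyMeasurable f (volume.restrict (Ioo 0 b)) :=
    h.continuousOn.aestronglyMeasurable measurableSet_Ioo
  have hf2 : MemLp f 2 (volume.restrict (Ioo 0 b)) :=
    (memLp_two_iff_integrable_sq_norm hfm).2 (h.integrableOn_norm_sq hb)
  refine ⟨hf2, g, h.hasWeakDeriv hb, h.memLp, fun ε hε => ?_⟩
  have hmem : h.memLp.toLp g ∈ (testDerivSubmodule b)ᗮᗮ := by
    refine (Submodule.mem_orthogonal _ _).2 fun v hv => ?_
    obtain ⟨C, hC⟩ := ae_eq_const_of_mem_orthogonal_testDeriv hb hv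
    rw [L2.inner_def]
    have : ∫ x in Ioo 0 b, inner ℂ ((v : ℝ → ℂ) x) ((h.memLp.toLp g : ℝ → ℂ) x) =
        ∫ x in Ioo 0 b, g x * (starRingEnd ℂ) C := by
      refine integral_congr_ae ?_
      filter_upwards [hC, h.memLp.coeFn_toLp] with x h1 h2
      rw [h1, h2, RCLike.inner_apply]
    rw [this, integral_mul_const, ← integral_Ioc_eq_integral_Ioo,
      ← intervalIntegral.integral_of_le hb.le, h0, zero_mul]
  rw [Submodule.orthogonal_orthogonal_eq_closure] at hmem
  -- `ε` may be `∞`, hence the truncation; the factor `1 + b` absorbs the norm of integration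
  set δ : ℝ := (min ε 1).toReal / (1 + b) with hδd
  have hmin : min ε 1 ≠ ⊤ := (min_le_right _ _).trans_lt ENNReal.one_lt_top |>.ne
  have hmin0 : 0 < (min ε 1).toReal := ENNReal.toReal_pos (lt_min hε one_pos).ne' hmin
  have hδ : 0 < δ := by positivity
  obtain ⟨u, ⟨φ, hφ, hu⟩, hlt⟩ := Metric.mem_closure_iff.1 hmem δ hδ
  have hg : eLpNorm (g - deriv φ) 2 (volume.restrict (Ioo 0 b)) < ENNReal.ofReal δ := by
    rw [dist_eq_norm, Lp.norm_def, ← ENNReal.lt_ofReal_iff_toReal_lt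
      (Lp.memLp _).eLpNorm_ne_top] at hlt
    refine lt_of_eq_of_lt (eLpNorm_congr_ae ?_) hlt
    filter_upwards [Lp.coeFn_sub (h.memLp.toLp g) u, h.memLp.coeFn_toLp, hu] with x h1 h2 h3
    rw [h1, Pi.sub_apply, Pi.sub_apply, h2, h3]
  have hle : ∀ {r : ℝ}, r < (min ε 1).toReal → ENNReal.ofReal r < ε := fun hr =>
    ((ENNReal.ofReal_lt_ofReal_iff hmin0).2 hr).trans_le
      ((ENNReal.ofReal_toReal hmin).le.trans (min_le_left _ _))
  have h1b : 0 < 1 + b := by positivity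
  refine ⟨φ, hφ, ((h.sub_testFunctions hφ).eLpNorm_le hb hδ hg).trans_lt (hle ?_),
    hg.trans (hle ?_)⟩
  · rw [hδd, ← mul_div_assoc, div_lt_iff₀ h1b]
    nlinarith
  · rw [hδd, div_lt_iff₀ h1b]
    nlinarith

/-- Functions of `𝒟_{D,N}` in `H¹((0,π))` are primitives, vanishing at `0`, of their derivatives:
a nonzero value at `0` would contradict the square integrability of `f' - f/(2x)`. -/
lemma exists_isL2Primitive_of_mem_formDomainDN
    (hf : f ∈ formDomainDN ∩ sobolevH1 (Ioo 0 Real.pi)) :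
    ∃ g, IsL2Primitive Real.pi f g ∧ HasWeakDeriv (Ioo 0 Real.pi) f g := by
  obtain ⟨⟨-, hac, -, hreg⟩, -, g, hfg, hg2⟩ := hf
  have hπ := Real.pi_pos
  set G : ℝ → ℂ := fun x => ∫ t in (0 : ℝ)..x, g t with hG
  have hP : IsL2Primitive Real.pi G g := ⟨hg2, fun x _ => rfl⟩
  have hsub := hfg.sub (hP.hasWeakDeriv hπ)
  rw [sub_self] at hsub
  obtain ⟨C, hC⟩ := hsub.ae_eq_const hπ
  have hfc : ContinuousOn f (Ioo 0 Real.pi) := by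
    intro x hx
    obtain ⟨a, ha, hax⟩ := exists_between hx.1
    obtain ⟨c, hxc, hc⟩ := exists_between hx.2
    have := (hac a c ha (hax.trans hxc).le hc).continuousOn
    rw [uIcc_of_le (hax.trans hxc).le] at this
    exact (this.continuousAt (Icc_mem_nhds hax hxc)).continuousWithinAt
  have heq : EqOn (f - G) (fun _ => C) (Ioo 0 Real.pi) :=
    Measure.eqOn_open_of_ae_eq hC isOpen_Ioo (hfc.sub hP.continuousOn) continuousOn_const
  have hfG : ∀ x ∈ Ioo 0 Real.pi, f x = G x + C := fun x hx => by
    have h1 : f x - G x = C := heq hx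
    rw [← h1]; ring
  -- almost everywhere, the classical derivative of `f` exists and equals `g`
  have hderiv : ∀ᵐ x ∂(volume.restrict (Ioo 0 Real.pi)), deriv f x = g x := by
    rw [ae_restrict_iff' measurableSet_Ioo]
    filter_upwards [(hP.intervalIntegrable hπ.le).ae_hasDerivAt_integral] with x hx hxm
    have h1 := (hx (by rw [uIcc_of_le hπ.le]; exact Ioo_subset_Icc_self hxm) 0
      (by simp)).add_const C
    refine (h1.congr_of_eventuallyEq ?_).deriv
    filter_upwards [isOpen_Ioo.mem_nhds hxm] with y hy using hfG y hy
  have hGm : MemLp (fun x : ℝ => G x / (x : ℂ)) 2 (volume.restrict (Ioo 0 Real.pi)) := by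
    have hm : AEStronglyMeasurable (fun x : ℝ => G x / (x : ℂ))
        (volume.restrict (Ioo 0 Real.pi)) := by
      refine ContinuousOn.aestronglyMeasurable (hP.continuousOn.div
        Complex.continuous_ofReal.continuousOn fun x hx => ?_) measurableSet_Ioo
      exact_mod_cast hx.1.ne'
    refine (memLp_two_iff_integrable_sq_norm hm).2 ?_
    refine (hP.integrableOn_norm_sq_div_sq hπ).congr (Eventually.of_forall fun x => ?_)
    simp only [norm_div, Complex.norm_real, div_pow, Real.norm_eq_abs, sq_abs]
  have hCm : MemLp (fun x : ℝ => C / (x : ℂ)) 2 (volume.restrict (Ioo 0 Real.pi)) := by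
    refine MemLp.ae_eq ?_ (((hg2.sub hreg).const_mul 2).sub hGm)
    filter_upwards [hderiv, ae_restrict_mem measurableSet_Ioo] with x h1 hx
    have hx0 : (x : ℂ) ≠ 0 := by exact_mod_cast hx.1.ne'
    simp only [Pi.sub_apply, h1, hfG x hx]
    field_simp
    ring
  have hC0 : C = 0 := by
    by_contra hne
    have h1 : IntegrableOn (fun x : ℝ => ‖C / (x : ℂ)‖ ^ 2) (Ioo 0 Real.pi) := by
      have := hCm.integrable_norm_pow (by norm_num)
      exact this
    have h2 : IntegrableOn (fun x : ℝ => x ^ (-2 : ℝ)) (Ioo 0 Real.pi) := by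
      have h3 : IntegrableOn (fun x : ℝ => 1 / ‖C‖ ^ 2 * ‖C / (x : ℂ)‖ ^ 2) (Ioo 0 Real.pi) :=
        h1.const_mul _
      refine h3.congr_fun (fun x hx => ?_) measurableSet_Ioo
      have hn : ‖C‖ ≠ 0 := norm_ne_zero_iff.2 hne
      have hx0 : x ≠ 0 := hx.1.ne'
      simp only [norm_div, Complex.norm_real, div_pow, Real.norm_eq_abs, sq_abs]
      rw [Real.rpow_neg hx.1.le, Real.rpow_ofNat]
      field_simp
    rw [intervalIntegral.integrableOn_Ioo_rpow_iff hπ] at h2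
    norm_num at h2
  exact ⟨g, ⟨hg2, fun x hx => by rw [hfG x hx, hC0, add_zero]⟩, hfg⟩

end Sobolev

/-! ### Trial functions -/

/-- The trial function `√x J₀(kx) χ(x)` on `(0,b)` with `χ(x) = (x e^{-x/b})^ε`. The factor `χ`
improves integrability at `0` and has vanishing derivative at `b`. -/
noncomputable def besselTrial (k b ε x : ℝ) : ℝ :=
  x ^ (1 / 2 + ε) * (Real.exp (-(ε * x / b)) * besselJ 0 (k * x))

/-- The derivative of `besselTrial`. -/
noncomputable def besselTrialDeriv (k b ε x : ℝ) : ℝ :=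
  x ^ (ε - 1 / 2) * (Real.exp (-(ε * x / b)) *
    (besselJ 0 (k * x) / 2 - k * x * besselJ 1 (k * x) + ε * besselJ 0 (k * x) * (1 - x / b)))

section Trial

variable {k b ε x : ℝ}

lemma continuous_besselJ_zero_mul (k : ℝ) : Continuous fun x => besselJ 0 (k * x) :=
  continuous_besselJ_zero.comp (by fun_prop)

lemma continuous_besselJ_one_mul (k : ℝ) : Continuous fun x => besselJ 1 (k * x) :=
  continuous_besselJ_one.comp (by fun_prop)

lemma hasDerivAt_exp_neg_mul_div (c b x : ℝ) : HasDerivAt (fun x => Real.exp (-(c * x / b)))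
    (Real.exp (-(c * x / b)) * (-(c / b))) x := by
  have := ((((hasDerivAt_id x).const_mul c).div_const b).neg).exp
  simpa using this

lemma hasDerivAt_besselTrial (hx : 0 < x) :
    HasDerivAt (besselTrial k b ε) (besselTrialDeriv k b ε x) x := by
  have h1 := Real.hasDerivAt_rpow_const (x := x) (p := 1 / 2 + ε) (Or.inl hx.ne')
  have h2 := hasDerivAt_exp_neg_mul_div ε b x
  have h3 := hasDerivAt_besselJ_zero_mul k x
  convert! h1.mul (h2.mul h3) using 1
  have e1 : (1 : ℝ) / 2 + ε - 1 = ε - 1 / 2 := by ring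
  have e2 : x ^ (1 / 2 + ε) = x ^ (ε - 1 / 2) * x := by
    rw [← Real.rpow_add_one hx.ne']; congr 1; ring
  simp only [besselTrialDeriv, e1, e2, Pi.mul_apply]
  ring

lemma continuous_besselTrial (hε : 0 < ε) : Continuous (besselTrial k b ε) := by
  have h1 : Continuous fun x : ℝ => x ^ (1 / 2 + ε) :=
    Real.continuous_rpow_const (by positivity)
  have h2 := continuous_besselJ_zero_mul k
  unfold besselTrial
  fun_prop

lemma besselTrial_zero (hε : 0 < ε) : besselTrial k b ε 0 = 0 := by
  rw [besselTrial, Real.zero_rpow (by positivity), zero_mul]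

lemma besselTrial_right_eq_zero (h : besselJ 0 (k * b) = 0) : besselTrial k b ε b = 0 := by
  rw [besselTrial, h, mul_zero, mul_zero]

lemma besselTrialDeriv_right_eq_zero (hb : 0 < b)
    (h : besselJ 0 (k * b) - 2 * (k * b) * besselJ 1 (k * b) = 0) :
    besselTrialDeriv k b ε b = 0 := by
  have e : besselJ 0 (k * b) / 2 - k * b * besselJ 1 (k * b) = 0 := by linarith
  rw [besselTrialDeriv, e, div_self hb.ne']
  ring

lemma intervalIntegrable_rpow_mul {s : ℝ} (hs : -1 < s) {h : ℝ → ℝ} (hh : Continuous h) (a c : ℝ) :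
    IntervalIntegrable (fun x => x ^ s * h x) volume a c :=
  (intervalIntegral.intervalIntegrable_rpow' hs).mul_continuousOn hh.continuousOn

/-- Continuity of the smooth factor of `besselTrialDeriv`, which is `√x u' + ε J₀(kx) (1 - x/b)`. -/
lemma continuous_trial_factor (k b ε : ℝ) : Continuous fun x => besselJ 0 (k * x) / 2 -
    k * x * besselJ 1 (k * x) + ε * besselJ 0 (k * x) * (1 - x / b) := by
  have h1 := continuous_besselJ_zero_mul k
  have h2 := continuous_besselJ_one_mul k
  fun_prop

lemma besselTrialDeriv_sq (hx : 0 < x) : besselTrialDeriv k b ε x ^ 2 =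
    x ^ (2 * ε - 1) * (Real.exp (-(2 * ε * x / b)) *
    (besselJ 0 (k * x) / 2 - k * x * besselJ 1 (k * x) +
      ε * besselJ 0 (k * x) * (1 - x / b)) ^ 2) := by
  have e1 : x ^ (2 * ε - 1) = (x ^ (ε - 1 / 2)) ^ 2 := by
    rw [← Real.rpow_mul_natCast hx.le]; congr 1; push_cast; ring
  have e2 : Real.exp (-(2 * ε * x / b)) = Real.exp (-(ε * x / b)) ^ 2 := by
    rw [← Real.exp_nat_mul]; congr 1; push_cast; ring
  rw [besselTrialDeriv, e1, e2]
  ring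

lemma besselTrial_sq (hx : 0 < x) : besselTrial k b ε x ^ 2 =
    x ^ (2 * ε - 1) * (Real.exp (-(2 * ε * x / b)) * (x ^ 2 * besselJ 0 (k * x) ^ 2)) := by
  have e1 : x ^ (2 * ε - 1) * x ^ 2 = (x ^ (1 / 2 + ε)) ^ 2 := by
    rw [← Real.rpow_mul_natCast hx.le, ← Real.rpow_natCast x 2, ← Real.rpow_add hx]
    congr 1; push_cast; ring
  have e2 : Real.exp (-(2 * ε * x / b)) = Real.exp (-(ε * x / b)) ^ 2 := by
    rw [← Real.exp_nat_mul]; congr 1; push_cast; ring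
  rw [besselTrial, mul_pow, ← e1, e2]
  ring

lemma besselTrial_sq_div (hx : 0 < x) : besselTrial k b ε x ^ 2 / x ^ 2 =
    x ^ (2 * ε - 1) * (Real.exp (-(2 * ε * x / b)) * besselJ 0 (k * x) ^ 2) := by
  rw [besselTrial_sq hx]
  field_simp

lemma isL2Primitive_besselTrial (k : ℝ) (hb : 0 < b) (hε : 0 < ε) :
    IsL2Primitive b (fun x => (besselTrial k b ε x : ℂ))
      (fun x => (besselTrialDeriv k b ε x : ℂ)) := by
  have hc := continuous_trial_factor k b ε
  have hi : ∀ c, IntervalIntegrable (besselTrialDeriv k b ε) volume 0 c := fun c =>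
    intervalIntegrable_rpow_mul (by linarith) (by fun_prop) 0 c
  have hi2 : IntegrableOn (fun x => besselTrialDeriv k b ε x ^ 2) (Ioo 0 b) := by
    have h1 := intervalIntegrable_rpow_mul (s := 2 * ε - 1) (by linarith)
      (h := fun x => Real.exp (-(2 * ε * x / b)) * (besselJ 0 (k * x) / 2 -
        k * x * besselJ 1 (k * x) + ε * besselJ 0 (k * x) * (1 - x / b)) ^ 2) (by fun_prop) 0 b
    rw [intervalIntegrable_iff_integrableOn_Ioo_of_le hb.le] at h1
    exact h1.congr_fun (fun x hx => (besselTrialDeriv_sq hx.1).symm) measurableSet_Ioo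
  refine ⟨?_, fun x hx => ?_⟩
  · have hm : AEStronglyMeasurable (fun x => (besselTrialDeriv k b ε x : ℂ))
        (volume.restrict (Ioo 0 b)) := by
      have h1 := hi b
      rw [intervalIntegrable_iff_integrableOn_Ioo_of_le hb.le] at h1
      exact Complex.continuous_ofReal.comp_aestronglyMeasurable h1.1
    refine (memLp_two_iff_integrable_sq_norm hm).2 ?_
    refine Integrable.congr hi2 (Eventually.of_forall fun x => ?_)
    simp only [Complex.norm_real, Real.norm_eq_abs, sq_abs]
  · rw [intervalIntegral.integral_ofReal, intervalIntegral.integral_eq_sub_of_hasDerivAt_of_le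
      hx.1.le (continuous_besselTrial hε).continuousOn
      (fun y hy => hasDerivAt_besselTrial hy.1) (hi x), besselTrial_zero hε, sub_zero]

/-- The energy defect of a trial function. The cross terms form the exact derivative of
`u u' χ²`, where `u(x) = √x J₀(kx)`, which vanishes at both endpoints. -/
lemma besselTrial_energy (hb : 0 < b) (hε : 0 < ε)
    (hB : besselJ 0 (k * b) * (besselJ 0 (k * b) - 2 * (k * b) * besselJ 1 (k * b)) = 0) :
    ∫ x in (0 : ℝ)..b, besselTrialDeriv k b ε x ^ 2 =
      1 / 4 * (∫ x in (0 : ℝ)..b, besselTrial k b ε x ^ 2 / x ^ 2) +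
      k ^ 2 * (∫ x in (0 : ℝ)..b, besselTrial k b ε x ^ 2) +
      ε ^ 2 * ∫ x in (0 : ℝ)..b, x ^ (2 * ε - 1) * (Real.exp (-(2 * ε * x / b)) *
        (besselJ 0 (k * x) ^ 2 * (1 - x / b) ^ 2)) := by
  have c0 := continuous_besselJ_zero_mul k
  have c1 := continuous_besselJ_one_mul k
  have hs : -1 < 2 * ε - 1 := by linarith
  have hIoc : ∀ {h₁ h₂ : ℝ → ℝ}, (∀ x, 0 < x → h₁ x = h₂ x) →
      ∫ x in (0 : ℝ)..b, h₁ x = ∫ x in (0 : ℝ)..b, h₂ x := by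
    intro h₁ h₂ h
    rw [intervalIntegral.integral_of_le hb.le, intervalIntegral.integral_of_le hb.le]
    exact setIntegral_congr_fun measurableSet_Ioc fun x hx => h x hx.1
  -- `B = u u' χ²`, with derivative `β`
  set B : ℝ → ℝ := fun x => x ^ (2 * ε) * (Real.exp (-(2 * ε * x / b)) *
    (besselJ 0 (k * x) * (besselJ 0 (k * x) / 2 - k * x * besselJ 1 (k * x)))) with hBdef
  set β : ℝ → ℝ := fun x => x ^ (2 * ε - 1) * (Real.exp (-(2 * ε * x / b)) *
    (2 * ε * (1 - x / b) * (besselJ 0 (k * x) * (besselJ 0 (k * x) / 2 -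
      k * x * besselJ 1 (k * x))) + (-(k * x * besselJ 0 (k * x) * besselJ 1 (k * x)) +
      (k * x * besselJ 1 (k * x)) ^ 2 - k ^ 2 * x ^ 2 * besselJ 0 (k * x) ^ 2))) with hβdef
  have hBcont : Continuous B := by
    have : Continuous fun x : ℝ => x ^ (2 * ε) := Real.continuous_rpow_const (by positivity)
    fun_prop
  have hβi : IntervalIntegrable β volume 0 b := intervalIntegrable_rpow_mul hs (by fun_prop) 0 b
  have hBβ : ∀ x ∈ Ioo 0 b, HasDerivAt B (β x) x := by
    intro x hx
    have h1 := Real.hasDerivAt_rpow_const (x := x) (p := 2 * ε) (Or.inl hx.1.ne')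
    have h2 := hasDerivAt_exp_neg_mul_div (2 * ε) b x
    have h3 := hasDerivAt_besselJ_zero_mul k x
    have h4 := hasDerivAt_mul_besselJ_one_mul k x
    convert! h1.mul (h2.mul (h3.mul ((h3.div_const 2).sub h4))) using 1
    have e2 : x ^ (2 * ε) = x ^ (2 * ε - 1) * x := by
      rw [← Real.rpow_add_one hx.1.ne']; congr 1; ring
    simp only [hβdef, e2, Pi.mul_apply, Pi.sub_apply]
    ring
  have hint : ∫ x in (0 : ℝ)..b, β x = 0 := by
    rw [intervalIntegral.integral_eq_sub_of_hasDerivAt_of_le hb.le hBcont.continuousOn hBβ hβi]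
    have h1 : B b = 0 := by
      have : besselJ 0 (k * b) * (besselJ 0 (k * b) / 2 - k * b * besselJ 1 (k * b)) = 0 := by
        linarith
      simp only [hBdef]
      rw [this, mul_zero, mul_zero]
    have h2 : B 0 = 0 := by
      simp only [hBdef]
      rw [Real.zero_rpow (by positivity), zero_mul]
    rw [h1, h2, sub_zero]
  rw [hIoc fun x hx => besselTrialDeriv_sq hx, hIoc fun x hx => besselTrial_sq_div hx,
    hIoc fun x hx => besselTrial_sq hx, ← intervalIntegral.integral_const_mul,
    ← intervalIntegral.integral_const_mul, ← intervalIntegral.integral_const_mul]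
  have i1 := (intervalIntegrable_rpow_mul hs (h := fun x => Real.exp (-(2 * ε * x / b)) *
    besselJ 0 (k * x) ^ 2) (by fun_prop) 0 b).const_mul (1 / 4)
  have i2 := (intervalIntegrable_rpow_mul hs (h := fun x => Real.exp (-(2 * ε * x / b)) *
    (x ^ 2 * besselJ 0 (k * x) ^ 2)) (by fun_prop) 0 b).const_mul (k ^ 2)
  have i3 := (intervalIntegrable_rpow_mul hs (h := fun x => Real.exp (-(2 * ε * x / b)) *
    (besselJ 0 (k * x) ^ 2 * (1 - x / b) ^ 2)) (by fun_prop) 0 b).const_mul (ε ^ 2)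
  refine (?_ : _ = _ + ∫ x in (0 : ℝ)..b, β x).trans (by rw [hint, add_zero])
  rw [← intervalIntegral.integral_add i1 i2,
    ← intervalIntegral.integral_add (i1.add i2) i3,
    ← intervalIntegral.integral_add ((i1.add i2).add i3) hβi]
  refine intervalIntegral.integral_congr fun x _ => ?_
  simp only [hβdef]
  ring

/-- Trial functions for the optimality of both constants: the defect is small and the Hardy term
is large, relative to the `L²` norm. As `ε → 0`, the Hardy term grows like `1/ε` and the defect is
of order `ε`, while the `L²` norm stays bounded above and below. -/
lemma exists_besselTrial (hb : 0 < b)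
    (hB : besselJ 0 (k * b) * (besselJ 0 (k * b) - 2 * (k * b) * besselJ 1 (k * b)) = 0)
    {δ : ℝ} (hδ : 0 < δ) (K : ℝ) : ∃ ε > 0,
    ∫ x in (0 : ℝ)..b, besselTrialDeriv k b ε x ^ 2 <
      1 / 4 * (∫ x in (0 : ℝ)..b, besselTrial k b ε x ^ 2 / x ^ 2) +
      (k ^ 2 + δ) * (∫ x in (0 : ℝ)..b, besselTrial k b ε x ^ 2) ∧
    K * (∫ x in (0 : ℝ)..b, besselTrial k b ε x ^ 2) <
      ∫ x in (0 : ℝ)..b, besselTrial k b ε x ^ 2 / x ^ 2 := by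
  have c0 := continuous_besselJ_zero_mul k
  -- an upper bound for `J₀(kx)` on `[0,b]`, and a lower bound near `0`
  obtain ⟨M, hM⟩ := isCompact_Icc.exists_bound_of_continuousOn (s := Icc 0 b) c0.continuousOn
  have hM0 : 0 ≤ M := (norm_nonneg _).trans (hM 0 (left_mem_Icc.2 hb.le))
  have hM2 : ∀ x ∈ Icc 0 b, besselJ 0 (k * x) ^ 2 ≤ M ^ 2 := fun x hx => by
    rw [← sq_abs]
    have := hM x hx
    rw [Real.norm_eq_abs] at this
    gcongr
  obtain ⟨r, hr, hrb, hr2⟩ : ∃ r > 0, r ≤ b ∧ ∀ x ∈ Icc 0 r, 1 / 4 ≤ besselJ 0 (k * x) ^ 2 := by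
    have h1 : ∀ᶠ x in 𝓝 (0 : ℝ), 1 / 2 < besselJ 0 (k * x) := by
      refine (c0.tendsto 0).eventually (lt_mem_nhds ?_)
      rw [mul_zero, besselJ_zero_zero]
      norm_num
    obtain ⟨r, hr, h2⟩ := Metric.eventually_nhds_iff.1 h1
    refine ⟨min (r / 2) b, by positivity, min_le_right _ _, fun x hx => ?_⟩
    have h3 := hx.2.trans (min_le_left _ _)
    have h4 := @h2 x (by rw [Real.dist_eq, sub_zero, abs_of_nonneg hx.1]; linarith)
    nlinarith
  set e₀ := Real.exp (-2) with he₀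
  have he₀' : 0 < e₀ := Real.exp_pos _
  -- each condition on `ε` holds as `ε → 0`
  have hpow : ∀ c : ℝ, 0 < c → Tendsto (fun ε : ℝ => c ^ (2 * ε)) (𝓝[>] 0) (𝓝 1) := by
    intro c hc
    have h1 : Continuous fun ε : ℝ => c ^ (2 * ε) :=
      Continuous.rpow continuous_const (by fun_prop) fun _ => Or.inl hc.ne'
    have h2 := h1.tendsto 0
    rw [mul_zero, Real.rpow_zero] at h2
    exact h2.mono_left nhdsWithin_le_nhds
  have hlin : ∀ c d : ℝ, 0 < d → ∀ᶠ ε in 𝓝[>] (0 : ℝ), ε * c < d := by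
    intro c d hd
    have h2 := (by fun_prop : Continuous fun ε : ℝ => ε * c).tendsto 0
    rw [zero_mul] at h2
    exact (h2.mono_left nhdsWithin_le_nhds).eventually (gt_mem_nhds hd)
  have hpos : ∀ᶠ ε in 𝓝[>] (0 : ℝ), 0 < ε := self_mem_nhdsWithin
  obtain ⟨ε, hε, hε1, hεb, hεr, hεδ, hεK⟩ := (hpos.and <|
    (hlin 1 1 one_pos).and <| ((hpow b hb).eventually (gt_mem_nhds one_lt_two)).and <|
      ((hpow (r / 2) (by positivity)).eventually (lt_mem_nhds one_half_lt_one)).and <|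
      (hlin (M ^ 2) (δ * (r ^ 2 * e₀ / 32)) (by positivity)).and
        (hlin (|K| * (2 * b ^ 2 * M ^ 2)) (e₀ / 16) (by positivity))).exists
  rw [mul_one] at hε1
  refine ⟨ε, hε, ?_⟩
  have hs : -1 < 2 * ε - 1 := by linarith
  have hIoc : ∀ {h₁ h₂ : ℝ → ℝ}, (∀ x, 0 < x → h₁ x = h₂ x) →
      ∫ x in (0 : ℝ)..b, h₁ x = ∫ x in (0 : ℝ)..b, h₂ x := by
    intro h₁ h₂ h
    rw [intervalIntegral.integral_of_le hb.le, intervalIntegral.integral_of_le hb.le]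
    exact setIntegral_congr_fun measurableSet_Ioc fun x hx => h x hx.1
  have hexp1 : ∀ x ∈ Icc 0 b, Real.exp (-(2 * ε * x / b)) ≤ 1 := fun x hx => by
    rw [Real.exp_le_one_iff]
    have := hx.1
    have : 0 ≤ 2 * ε * x / b := by positivity
    linarith
  have hexp2 : ∀ x ∈ Icc 0 b, e₀ ≤ Real.exp (-(2 * ε * x / b)) := fun x hx => by
    rw [he₀, Real.exp_le_exp]
    have h1 : x / b ≤ 1 := (div_le_one hb).2 hx.2
    have h2 : 0 ≤ x / b := div_nonneg hx.1 hb.le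
    have h3 : 2 * ε * x / b = 2 * ε * (x / b) := by ring
    rw [h3]
    nlinarith
  have hrpow : ∀ c : ℝ, ∫ x in (0 : ℝ)..c, x ^ (2 * ε - 1) = c ^ (2 * ε) / (2 * ε) := fun c => by
    rw [integral_rpow (Or.inl hs), sub_add_cancel, Real.zero_rpow (by positivity), sub_zero]
  set N := ∫ x in (0 : ℝ)..b, besselTrial k b ε x ^ 2 / x ^ 2 with hN
  set L := ∫ x in (0 : ℝ)..b, besselTrial k b ε x ^ 2 with hL
  have hN' : N = ∫ x in (0 : ℝ)..b, x ^ (2 * ε - 1) *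
      (Real.exp (-(2 * ε * x / b)) * besselJ 0 (k * x) ^ 2) :=
    hIoc fun x hx => besselTrial_sq_div hx
  have iN := intervalIntegrable_rpow_mul hs (h := fun x => Real.exp (-(2 * ε * x / b)) *
    besselJ 0 (k * x) ^ 2) (by fun_prop) 0 b
  have hcT : Continuous fun x => besselTrial k b ε x ^ 2 := (continuous_besselTrial hε).pow 2
  have hDle : ∫ x in (0 : ℝ)..b, x ^ (2 * ε - 1) * (Real.exp (-(2 * ε * x / b)) *
      (besselJ 0 (k * x) ^ 2 * (1 - x / b) ^ 2)) ≤ M ^ 2 / ε := by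
    have h1 : ∫ x in (0 : ℝ)..b, x ^ (2 * ε - 1) * (Real.exp (-(2 * ε * x / b)) *
        (besselJ 0 (k * x) ^ 2 * (1 - x / b) ^ 2)) ≤
        ∫ x in (0 : ℝ)..b, x ^ (2 * ε - 1) * M ^ 2 := by
      refine intervalIntegral.integral_mono_on hb.le
        (intervalIntegrable_rpow_mul hs (by fun_prop) 0 b)
        (intervalIntegrable_rpow_mul hs continuous_const 0 b) fun x hx => ?_
      refine mul_le_mul_of_nonneg_left ?_ (Real.rpow_nonneg hx.1 _)
      have h2 : (1 - x / b) ^ 2 ≤ 1 := by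
        have h1 : x / b ≤ 1 := (div_le_one hb).2 hx.2
        have h2 : 0 ≤ x / b := div_nonneg hx.1 hb.le
        nlinarith
      calc _ ≤ 1 * (M ^ 2 * 1) :=
            mul_le_mul (hexp1 x hx) (mul_le_mul (hM2 x hx) h2 (sq_nonneg _) (sq_nonneg _))
              (by positivity) zero_le_one
        _ = M ^ 2 := by ring
    refine h1.trans ?_
    rw [intervalIntegral.integral_mul_const, hrpow, div_mul_eq_mul_div,
      div_le_div_iff₀ (by positivity) hε]
    nlinarith [mul_nonneg (sq_nonneg M) hε.le]
  have hNge : e₀ / (16 * ε) ≤ N := by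
    have h1 : ∫ x in (0 : ℝ)..r, x ^ (2 * ε - 1) * (e₀ * (1 / 4)) ≤
        ∫ x in (0 : ℝ)..r, x ^ (2 * ε - 1) *
          (Real.exp (-(2 * ε * x / b)) * besselJ 0 (k * x) ^ 2) := by
      refine intervalIntegral.integral_mono_on hr.le
        (intervalIntegrable_rpow_mul hs continuous_const 0 r)
        (intervalIntegrable_rpow_mul hs (by fun_prop) 0 r) fun x hx => ?_
      refine mul_le_mul_of_nonneg_left ?_ (Real.rpow_nonneg hx.1 _)
      exact mul_le_mul (hexp2 x ⟨hx.1, hx.2.trans hrb⟩) (hr2 x hx) (by norm_num) (Real.exp_pos _).le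
    have h2 : ∫ x in (0 : ℝ)..r, x ^ (2 * ε - 1) *
          (Real.exp (-(2 * ε * x / b)) * besselJ 0 (k * x) ^ 2) ≤ N := by
      rw [hN']
      refine intervalIntegral.integral_mono_interval le_rfl hr.le hrb ?_ iN
      rw [EventuallyLE, ae_restrict_iff' measurableSet_Ioc]
      refine Eventually.of_forall fun x hx => ?_
      have := Real.rpow_nonneg hx.1.le (2 * ε - 1)
      simp only [Pi.zero_apply]
      positivity
    rw [intervalIntegral.integral_mul_const, hrpow] at h1
    have h3 : (r / 2) ^ (2 * ε) ≤ r ^ (2 * ε) :=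
      Real.rpow_le_rpow (by positivity) (by linarith) (by positivity)
    have h4 : e₀ / (16 * ε) ≤ r ^ (2 * ε) / (2 * ε) * (e₀ * (1 / 4)) := by
      have : r ^ (2 * ε) / (2 * ε) * (e₀ * (1 / 4)) = (2 * r ^ (2 * ε)) * (e₀ / (16 * ε)) := by
        field_simp
        ring
      rw [this]
      have h5 : 0 < e₀ / (16 * ε) := by positivity
      nlinarith
    linarith
  have hLle : L ≤ 2 * b ^ 2 * M ^ 2 := by
    have h1 : L ≤ ∫ _x in (0 : ℝ)..b, 2 * b * M ^ 2 := by
      refine intervalIntegral.integral_mono_on hb.le (hcT.intervalIntegrable _ _) (by simp)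
        fun x hx => ?_
      rcases hx.1.eq_or_lt with rfl | hx0
      · rw [besselTrial_zero hε, zero_pow two_ne_zero]
        positivity
      rw [besselTrial_sq hx0]
      have h2 : x ^ (2 * ε - 1) * x ^ 2 = x ^ (2 * ε) * x := by
        rw [Real.rpow_sub_one hx0.ne']
        field_simp
      have h3 : x ^ (2 * ε) ≤ b ^ (2 * ε) := Real.rpow_le_rpow hx.1 hx.2 (by positivity)
      calc _ = x ^ (2 * ε) * x * (Real.exp (-(2 * ε * x / b)) * besselJ 0 (k * x) ^ 2) := by
            rw [← h2]; ring
        _ ≤ 2 * b * (1 * M ^ 2) :=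
            mul_le_mul (mul_le_mul (h3.trans hεb.le) hx.2 hx.1 zero_le_two)
              (mul_le_mul (hexp1 x hx) (hM2 x hx) (sq_nonneg _) zero_le_one)
              (by positivity) (by positivity)
        _ = _ := by ring
    rw [intervalIntegral.integral_const, smul_eq_mul, sub_zero] at h1
    linarith
  have hLge : r ^ 2 * e₀ / 32 ≤ L := by
    have h1 : ∫ _x in (r / 2)..r, r / 2 * (1 / 2) * (e₀ * (1 / 4)) ≤
        ∫ x in (r / 2)..r, besselTrial k b ε x ^ 2 := by
      refine intervalIntegral.integral_mono_on (by linarith) (by simp)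
        (hcT.intervalIntegrable _ _) fun x hx => ?_
      have hx0 : 0 < x := by linarith [hx.1]
      have hxb : x ∈ Icc 0 b := ⟨hx0.le, hx.2.trans hrb⟩
      rw [besselTrial_sq hx0]
      have h2 : x ^ (2 * ε - 1) * x ^ 2 = x * x ^ (2 * ε) := by
        rw [Real.rpow_sub_one hx0.ne']
        field_simp
      have h3 : (r / 2) ^ (2 * ε) ≤ x ^ (2 * ε) :=
        Real.rpow_le_rpow (by positivity) hx.1 (by positivity)
      calc _ ≤ x * x ^ (2 * ε) * (Real.exp (-(2 * ε * x / b)) * besselJ 0 (k * x) ^ 2) := by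
            gcongr
            · exact hx.1
            · exact hεr.le.trans h3
            · exact hexp2 x hxb
            · exact hr2 x ⟨hx0.le, hx.2⟩
        _ = _ := by rw [← h2]; ring
    have h2 : ∫ x in (r / 2)..r, besselTrial k b ε x ^ 2 ≤ L :=
      intervalIntegral.integral_mono_interval (by positivity) (by linarith) hrb
        (Eventually.of_forall fun x => by positivity) (hcT.intervalIntegrable _ _)
    rw [intervalIntegral.integral_const, smul_eq_mul] at h1
    have h3 : (r - r / 2) * (r / 2 * (1 / 2) * (e₀ * (1 / 4))) = r ^ 2 * e₀ / 32 := by ring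
    linarith
  constructor
  · rw [besselTrial_energy hb hε hB]
    have h1 : ε ^ 2 * (M ^ 2 / ε) = ε * M ^ 2 := by field_simp
    have h2 := mul_le_mul_of_nonneg_left hDle (sq_nonneg ε)
    have h3 := mul_le_mul_of_nonneg_left hLge hδ.le
    rw [h1] at h2
    linarith
  · have hL0 : 0 ≤ L := le_trans (by positivity) hLge
    have h1 : K * L ≤ |K| * (2 * b ^ 2 * M ^ 2) :=
      mul_le_mul (le_abs_self K) hLle hL0 (abs_nonneg K)
    have h2 : |K| * (2 * b ^ 2 * M ^ 2) < e₀ / (16 * ε) := by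
      rw [lt_div_iff₀ (by positivity)]
      linarith
    linarith

end Trial

/-! ### Reflection about the midpoint of an interval -/

section Reflection

variable {E : Type*} [NormedAddCommGroup E] {b c : ℝ}

lemma integrableOn_Ioo_iff_reflect {h : ℝ → E} (hb : 0 < b) (hc : c = 2 * b) :
    IntegrableOn h (Ioo 0 c) ↔
      IntegrableOn h (Ioo 0 b) ∧ IntegrableOn (fun x => h (c - x)) (Ioo 0 b) := by
  have hbc : b ≤ c := by linarith
  have h0c : 0 ≤ c := by linarith
  have e1 : c - b = b := by linarith
  rw [← intervalIntegrable_iff_integrableOn_Ioo_of_le hb.le,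
    ← intervalIntegrable_iff_integrableOn_Ioo_of_le h0c,
    ← intervalIntegrable_iff_integrableOn_Ioo_of_le hb.le]
  constructor
  · intro h1
    have h2 : IntervalIntegrable h volume b c := h1.mono_set (by
      rw [uIcc_of_le hbc, uIcc_of_le h0c]; exact Icc_subset_Icc_left hb.le)
    have h3 := h2.comp_sub_left c
    rw [sub_self, e1] at h3
    exact ⟨h1.mono_set (by
      rw [uIcc_of_le hb.le, uIcc_of_le h0c]; exact Icc_subset_Icc_right hbc), h3.symm⟩
  · rintro ⟨h1, h2⟩
    have h3 := h2.comp_sub_left c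
    simp only [sub_sub_cancel, sub_zero, e1] at h3
    exact h1.trans h3.symm

lemma integral_Ioo_eq_add_reflect [NormedSpace ℝ E] {h : ℝ → E} (hb : 0 < b) (hc : c = 2 * b)
    (hi : IntegrableOn h (Ioo 0 c)) :
    ∫ x in Ioo 0 c, h x = (∫ x in Ioo 0 b, h x) + ∫ x in Ioo 0 b, h (c - x) := by
  have hbc : b ≤ c := by linarith
  have h0c : 0 ≤ c := by linarith
  have e1 : c - b = b := by linarith
  rw [← intervalIntegrable_iff_integrableOn_Ioo_of_le h0c] at hi
  have h2 : IntervalIntegrable h volume b c := hi.mono_set (by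
      rw [uIcc_of_le hbc, uIcc_of_le h0c]; exact Icc_subset_Icc_left hb.le)
  have h1 : IntervalIntegrable h volume 0 b := hi.mono_set (by
      rw [uIcc_of_le hb.le, uIcc_of_le h0c]; exact Icc_subset_Icc_right hbc)
  simp only [← integral_Ioc_eq_integral_Ioo, ← intervalIntegral.integral_of_le hb.le,
    ← intervalIntegral.integral_of_le h0c]
  rw [intervalIntegral.integral_comp_sub_left, sub_zero, e1,
    intervalIntegral.integral_add_adjacent_intervals h1 h2]

/-- The even extension of a primitive across `b`, and its derivative. -/
lemma IsL2Primitive.even_extension {F g : ℝ → ℂ} (h : IsL2Primitive b F g) (hb : 0 < b)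
    (hc : c = 2 * b) (hFb : F b = ∫ t in (0 : ℝ)..b, g t) :
    IsL2Primitive c (fun x => if x ≤ b then F x else F (c - x))
      (fun x => if x ≤ b then g x else -g (c - x)) ∧
    ∫ t in (0 : ℝ)..c, (if t ≤ b then g t else -g (c - t)) = 0 := by
  set G : ℝ → ℂ := fun x => if x ≤ b then g x else -g (c - x) with hG
  have hbc : b ≤ c := by linarith
  have h0c : 0 ≤ c := by linarith
  have e1 : ∀ x ∈ Ioo 0 b, G x = g x := fun x hx => if_pos hx.2.le
  have e2 : ∀ x ∈ Ioo 0 b, G (c - x) = -g x := fun x hx => by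
    simp only [hG]
    rw [if_neg (by linarith [hx.2]), sub_sub_cancel]
  have hgi : IntegrableOn g (Ioo 0 b) := h.memLp.integrable (by norm_num)
  have hGi : IntegrableOn G (Ioo 0 c) := by
    rw [integrableOn_Ioo_iff_reflect hb hc]
    have hneg : IntegrableOn (fun x => -g x) (Ioo 0 b) := hgi.neg
    exact ⟨hgi.congr_fun (fun x hx => (e1 x hx).symm) measurableSet_Ioo,
      hneg.congr_fun (fun x hx => (e2 x hx).symm) measurableSet_Ioo⟩
  have hGi2 : IntegrableOn (fun x => ‖G x‖ ^ 2) (Ioo 0 c) := by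
    rw [integrableOn_Ioo_iff_reflect hb hc]
    exact ⟨h.integrableOn_sq.congr_fun (fun x hx => by simp only [e1 x hx]) measurableSet_Ioo,
      h.integrableOn_sq.congr_fun (fun x hx => by simp only [e2 x hx, norm_neg])
        measurableSet_Ioo⟩
  have hGi' := hGi
  rw [← intervalIntegrable_iff_integrableOn_Ioo_of_le h0c] at hGi'
  have hleft : ∀ x, x ≤ b → 0 ≤ x → ∫ t in (0 : ℝ)..x, G t = ∫ t in (0 : ℝ)..x, g t := by
    intro x hx hx0
    refine intervalIntegral.integral_congr fun t ht => ?_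
    rw [uIcc_of_le hx0] at ht
    exact if_pos (ht.2.trans hx)
  refine ⟨⟨(memLp_two_iff_integrable_sq_norm hGi.1).2 hGi2, fun x hx => ?_⟩, ?_⟩
  · split_ifs with hxb
    · rw [hleft x hxb hx.1.le]
      rcases hxb.eq_or_lt with rfl | hlt
      · exact hFb
      · exact h.eq_integral x ⟨hx.1, hlt⟩
    · push Not at hxb
      have i1 : IntervalIntegrable G volume 0 b := hGi'.mono_set (by
        rw [uIcc_of_le hb.le, uIcc_of_le h0c]; exact Icc_subset_Icc_right hbc)
      have i2 : IntervalIntegrable G volume b x := hGi'.mono_set (by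
        rw [uIcc_of_le hxb.le, uIcc_of_le h0c]; exact Icc_subset_Icc hb.le hx.2.le)
      have hgi' := h.intervalIntegrable hb.le
      have hx' : c - x ∈ Ioo 0 b := ⟨by linarith [hx.2], by linarith⟩
      have j1 : IntervalIntegrable g volume 0 (c - x) := hgi'.mono_set (by
        rw [uIcc_of_le hx'.1.le, uIcc_of_le hb.le]; exact Icc_subset_Icc_right hx'.2.le)
      have j2 : IntervalIntegrable g volume (c - x) b := hgi'.mono_set (by
        rw [uIcc_of_le hx'.2.le, uIcc_of_le hb.le]; exact Icc_subset_Icc_left hx'.1.le)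
      have e3 : ∫ t in b..x, G t = ∫ t in b..x, -g (c - t) := by
        rw [intervalIntegral.integral_of_le hxb.le, intervalIntegral.integral_of_le hxb.le]
        exact setIntegral_congr_fun measurableSet_Ioc fun t ht => if_neg (not_le.2 ht.1)
      rw [← intervalIntegral.integral_add_adjacent_intervals i1 i2, hleft b le_rfl hb.le, e3,
        intervalIntegral.integral_neg, intervalIntegral.integral_comp_sub_left,
        show c - b = b by linarith, h.eq_integral _ hx',
        ← intervalIntegral.integral_add_adjacent_intervals j1 j2]
      ring
  · rw [intervalIntegral.integral_of_le h0c, integral_Ioc_eq_integral_Ioo,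
      integral_Ioo_eq_add_reflect hb hc hGi, setIntegral_congr_fun measurableSet_Ioo e1,
      setIntegral_congr_fun measurableSet_Ioo e2, integral_neg, add_neg_cancel]

end Reflection

/-! ### The three sharp inequalities -/

/-- A criterion for `IsSharpStrictHardy`: the inequality and its equality case need only be checked
for one representative and one weak derivative of each function, and a single family of trial
functions yields the optimality of both constants. -/
lemma IsSharpStrictHardy.of_representatives {D : Set (ℝ → ℂ)} {w : ℝ → ℝ} {a c : ℝ}
    (h : ∀ f ∈ D, ∃ F g, f =ᵐ[volume.restrict (Ioo 0 Real.pi)] F ∧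
      HasWeakDeriv (Ioo 0 Real.pi) f g ∧
      IntegrableOn (fun x => ‖F x‖ ^ 2 / w x ^ 2) (Ioo 0 Real.pi) ∧
      a * (∫ x in Ioo 0 Real.pi, ‖F x‖ ^ 2 / w x ^ 2) + c * (∫ x in Ioo 0 Real.pi, ‖F x‖ ^ 2)
        ≤ ∫ x in Ioo 0 Real.pi, ‖g x‖ ^ 2 ∧
      (a * (∫ x in Ioo 0 Real.pi, ‖F x‖ ^ 2 / w x ^ 2) + c * (∫ x in Ioo 0 Real.pi, ‖F x‖ ^ 2)
        = ∫ x in Ioo 0 Real.pi, ‖g x‖ ^ 2 → F =ᵐ[volume.restrict (Ioo 0 Real.pi)] 0))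
    (hopt : ∀ δ > 0, ∀ K : ℝ, ∃ f ∈ D, ∃ g, HasWeakDeriv (Ioo 0 Real.pi) f g ∧
      ∫ x in Ioo 0 Real.pi, ‖g x‖ ^ 2 < a * (∫ x in Ioo 0 Real.pi, ‖f x‖ ^ 2 / w x ^ 2) +
        (c + δ) * (∫ x in Ioo 0 Real.pi, ‖f x‖ ^ 2) ∧
      K * (∫ x in Ioo 0 Real.pi, ‖f x‖ ^ 2) < ∫ x in Ioo 0 Real.pi, ‖f x‖ ^ 2 / w x ^ 2) :
    IsSharpStrictHardy D w a c := by
  have hcongr : ∀ {f F g g' : ℝ → ℂ}, f =ᵐ[volume.restrict (Ioo 0 Real.pi)] F →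
      HasWeakDeriv (Ioo 0 Real.pi) f g → HasWeakDeriv (Ioo 0 Real.pi) f g' →
      (∫ x in Ioo 0 Real.pi, ‖f x‖ ^ 2 / w x ^ 2) = (∫ x in Ioo 0 Real.pi, ‖F x‖ ^ 2 / w x ^ 2) ∧
      (∫ x in Ioo 0 Real.pi, ‖f x‖ ^ 2) = (∫ x in Ioo 0 Real.pi, ‖F x‖ ^ 2) ∧
      (∫ x in Ioo 0 Real.pi, ‖g x‖ ^ 2) = (∫ x in Ioo 0 Real.pi, ‖g' x‖ ^ 2) := by
    intro f F g g' hfF hg hg'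
    refine ⟨integral_congr_ae ?_, integral_congr_ae ?_, integral_congr_ae ?_⟩
    · filter_upwards [hfF] with x hx
      rw [hx]
    · filter_upwards [hfF] with x hx
      rw [hx]
    · filter_upwards [hg.ae_unique isOpen_Ioo hg'] with x hx
      rw [hx]
  have hle : ∀ f ∈ D, ∀ g, HasWeakDeriv (Ioo 0 Real.pi) f g →
      a * (∫ x in Ioo 0 Real.pi, ‖f x‖ ^ 2 / w x ^ 2) + c * (∫ x in Ioo 0 Real.pi, ‖f x‖ ^ 2)
        ≤ ∫ x in Ioo 0 Real.pi, ‖g x‖ ^ 2 := by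
    intro f hf g hg
    obtain ⟨F, g', hfF, hg', -, hle, -⟩ := h f hf
    obtain ⟨e1, e2, e3⟩ := hcongr hfF hg hg'
    rw [e1, e2, e3]
    exact hle
  refine ⟨fun f hf => ?_, hle, fun f hf g hg hne => lt_of_le_of_ne (hle f hf g hg) ?_,
    fun a' ha' c' => ?_, fun c' hc' => ?_⟩
  · obtain ⟨F, g', hfF, -, hi, -⟩ := h f hf
    refine Integrable.congr hi ?_
    filter_upwards [hfF] with x hx
    rw [hx]
  · obtain ⟨F, g', hfF, hg', -, -, heq⟩ := h f hf
    obtain ⟨e1, e2, e3⟩ := hcongr hfF hg hg'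
    rw [e1, e2, e3]
    exact fun h0 => hne (hfF.trans (heq h0))
  · have ha0 : 0 < a' - a := sub_pos.2 ha'
    obtain ⟨f, hf, g, hg, h1, h2⟩ := hopt 1 one_pos (|c + 1 - c'| / (a' - a))
    refine ⟨f, hf, g, hg, h1.trans ?_⟩
    have hL : 0 ≤ ∫ x in Ioo 0 Real.pi, ‖f x‖ ^ 2 := integral_nonneg fun x => by positivity
    rw [div_mul_eq_mul_div, div_lt_iff₀ ha0] at h2
    have h3 := mul_le_mul_of_nonneg_right (le_abs_self (c + 1 - c')) hL
    linarith
  · obtain ⟨f, hf, g, hg, h1, -⟩ := hopt (c' - c) (sub_pos.2 hc') 0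
    refine ⟨f, hf, g, hg, ?_⟩
    rwa [add_sub_cancel] at h1

/-- The trial functions of `exists_besselTrial`, as complex functions and with integrals over
`(0,b)`. -/
lemma exists_besselTrial_complex {k b : ℝ} (hb : 0 < b)
    (hB : besselJ 0 (k * b) * (besselJ 0 (k * b) - 2 * (k * b) * besselJ 1 (k * b)) = 0)
    {δ : ℝ} (hδ : 0 < δ) (K : ℝ) : ∃ ε > 0,
    ∫ x in Ioo 0 b, ‖(besselTrialDeriv k b ε x : ℂ)‖ ^ 2 <
      1 / 4 * (∫ x in Ioo 0 b, ‖(besselTrial k b ε x : ℂ)‖ ^ 2 / x ^ 2) +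
      (k ^ 2 + δ) * (∫ x in Ioo 0 b, ‖(besselTrial k b ε x : ℂ)‖ ^ 2) ∧
    K * (∫ x in Ioo 0 b, ‖(besselTrial k b ε x : ℂ)‖ ^ 2) <
      ∫ x in Ioo 0 b, ‖(besselTrial k b ε x : ℂ)‖ ^ 2 / x ^ 2 := by
  obtain ⟨ε, hε, h⟩ := exists_besselTrial hb hB hδ K
  refine ⟨ε, hε, ?_⟩
  simp only [intervalIntegral.integral_of_le hb.le, integral_Ioc_eq_integral_Ioo] at h
  simpa only [Complex.norm_real, Real.norm_eq_abs, sq_abs] using h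

lemma besselTrial_right_eq_integral {k b ε : ℝ} (hb : 0 < b) (hε : 0 < ε) :
    (besselTrial k b ε b : ℂ) = ∫ t in (0 : ℝ)..b, (besselTrialDeriv k b ε t : ℂ) := by
  have h1 := (isL2Primitive_besselTrial k hb hε).tendsto_left hb
  have h2 := (((continuous_besselTrial (k := k) (b := b) hε).tendsto b).mono_left
    (nhdsWithin_le_nhds (s := Iio b)))
  exact tendsto_nhds_unique ((Complex.continuous_ofReal.tendsto _).comp h2) h1

/-- Under the Neumann condition on the ground state the trial functions lie in the
Dirichlet–Neumann domain: both factors have vanishing derivative at `π`. -/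
lemma besselTrial_mem_formDomainDN {k ε : ℝ} (hε : 0 < ε)
    (hN : besselJ 0 (k * Real.pi) - 2 * (k * Real.pi) * besselJ 1 (k * Real.pi) = 0) :
    (fun x => (besselTrial k Real.pi ε x : ℂ)) ∈
      formDomainDN ∩ sobolevH1 (Ioo 0 Real.pi) := by
  have hπ := Real.pi_pos
  have hP := isL2Primitive_besselTrial k hπ hε
  have hc : Continuous fun x => (besselTrial k Real.pi ε x : ℂ) :=
    Complex.continuous_ofReal.comp (continuous_besselTrial hε)
  have hd : ∀ x, 0 < x → HasDerivAt (fun x => (besselTrial k Real.pi ε x : ℂ))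
      (besselTrialDeriv k Real.pi ε x) x := fun x hx => (hasDerivAt_besselTrial hx).ofReal_comp
  have hL2 : MemLp (fun x => (besselTrial k Real.pi ε x : ℂ)) 2
      (volume.restrict (Ioo 0 Real.pi)) :=
    (memLp_two_iff_integrable_sq_norm hc.aestronglyMeasurable).2 (hP.integrableOn_norm_sq hπ)
  refine ⟨⟨hL2, fun a b ha hab hb => (hP.isPrimitiveOn ha hab hb).absolutelyContinuousOnInterval,
    ?_, ?_⟩, hL2, _, hP.hasWeakDeriv hπ, hP.memLp⟩
  · have := hd _ hπ
    rw [besselTrialDeriv_right_eq_zero hπ hN, Complex.ofReal_zero] at this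
    exact this.hasDerivWithinAt
  · have hm : AEStronglyMeasurable (fun x : ℝ => (besselTrial k Real.pi ε x : ℂ) / (2 * (x : ℂ)))
        (volume.restrict (Ioo 0 Real.pi)) := by
      refine ContinuousOn.aestronglyMeasurable (hc.continuousOn.div
        (by fun_prop) fun x hx => ?_) measurableSet_Ioo
      have : (x : ℂ) ≠ 0 := by exact_mod_cast hx.1.ne'
      simpa using this
    have hq : MemLp (fun x : ℝ => (besselTrial k Real.pi ε x : ℂ) / (2 * (x : ℂ))) 2
        (volume.restrict (Ioo 0 Real.pi)) := by
      refine (memLp_two_iff_integrable_sq_norm hm).2 ?_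
      refine ((hP.integrableOn_norm_sq_div_sq hπ).const_mul (1 / 4)).congr
        (Eventually.of_forall fun x => ?_)
      simp only [norm_div, norm_mul, Complex.norm_real, div_pow, mul_pow, Real.norm_eq_abs, sq_abs,
        Complex.norm_ofNat]
      ring
    refine MemLp.ae_eq ?_ (hP.memLp.sub hq)
    filter_upwards [ae_restrict_mem measurableSet_Ioo] with x hx
    simp only [Pi.sub_apply, (hd x hx.1).deriv]

lemma lambConstant_pos : 0 < lambConstant := isLeast_lambZeros.1.1

/-- The Neumann condition at `b` for `√x J₀(kx)` with `kb` equal to Lamb's constant. -/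
lemma neumann_of_mul_eq_lambConstant {k b : ℝ} (h : k * b = lambConstant) :
    besselJ 0 (k * b) - 2 * (k * b) * besselJ 1 (k * b) = 0 := by
  rw [h]
  exact isLeast_lambZeros.1.2

lemma besselJ_zero_mul_pos {k b j : ℝ} (hb : 0 < b) (h : k * b = j) (hj0 : 0 < j)
    (hj : j ≤ sInf besselJ0Zeros) : ∀ x ∈ Ioo 0 b, 0 < besselJ 0 (k * x) := by
  intro x hx
  have hk : 0 < k := by
    by_contra! hk
    nlinarith
  refine besselJ_zero_pos (mul_pos hk hx.1).le (lt_of_lt_of_le ?_ hj)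
  rw [← h]
  exact mul_lt_mul_of_pos_left hx.2 hk

/-- The sharp inequality on `(0,b)` without boundary condition at `b`. -/
lemma IsL2Primitive.lamb_hardy {k b : ℝ} {F g : ℝ → ℂ} (h : IsL2Primitive b F g) (hb : 0 < b)
    (hk : k * b = lambConstant) :
    1 / 4 * (∫ x in Ioo 0 b, ‖F x‖ ^ 2 / x ^ 2) + k ^ 2 * (∫ x in Ioo 0 b, ‖F x‖ ^ 2) ≤
        ∫ x in Ioo 0 b, ‖g x‖ ^ 2 ∧
    (1 / 4 * (∫ x in Ioo 0 b, ‖F x‖ ^ 2 / x ^ 2) + k ^ 2 * (∫ x in Ioo 0 b, ‖F x‖ ^ 2) =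
        ∫ x in Ioo 0 b, ‖g x‖ ^ 2 → ∀ x ∈ Ioo 0 b, F x = 0) :=
  h.bessel_hardy hb (besselJ_zero_mul_pos hb hk lambConstant_pos lambConstant_lt.le)
    (h.tendsto_besselW_neumann hb
      (by rw [hk]; exact besselJ_zero_pos lambConstant_pos.le lambConstant_lt)
      (neumann_of_mul_eq_lambConstant hk))

lemma ae_eq_zero_of_forall_mem_Ioo {b : ℝ} {F : ℝ → ℂ} (h : ∀ x ∈ Ioo 0 b, F x = 0) :
    F =ᵐ[volume.restrict (Ioo 0 b)] 0 := by
  filter_upwards [ae_restrict_mem measurableSet_Ioo] with x hx using h x hx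

theorem isSharpStrictHardy_formDomainDN :
    IsSharpStrictHardy (formDomainDN ∩ sobolevH1 (Ioo 0 Real.pi)) (fun x => x)
      (1 / 4) (lambdaDN / Real.pi ^ 2) := by
  have hπ := Real.pi_pos
  have hk : lambConstant / Real.pi * Real.pi = lambConstant := by field_simp
  have hk2 : lambdaDN / Real.pi ^ 2 = (lambConstant / Real.pi) ^ 2 := by rw [lambdaDN, div_pow]
  rw [hk2]
  have hN := neumann_of_mul_eq_lambConstant hk
  refine IsSharpStrictHardy.of_representatives (fun f hf => ?_) fun δ hδ K => ?_
  · obtain ⟨g, hP, hg⟩ := exists_isL2Primitive_of_mem_formDomainDN hf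
    obtain ⟨h1, h2⟩ := hP.lamb_hardy hπ hk
    exact ⟨f, g, EventuallyEq.rfl, hg, hP.integrableOn_norm_sq_div_sq hπ, h1,
      fun h => ae_eq_zero_of_forall_mem_Ioo (h2 h)⟩
  · obtain ⟨ε, hε, h1, h2⟩ := exists_besselTrial_complex hπ (by rw [hN, mul_zero]) hδ K
    exact ⟨_, besselTrial_mem_formDomainDN hε hN, _,
      (isL2Primitive_besselTrial _ hπ hε).hasWeakDeriv hπ, h1, h2⟩

theorem isSharpStrictHardy_sobolevH10 :
    IsSharpStrictHardy (sobolevH10 (Ioo 0 Real.pi)) (fun x => x)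
      (1 / 4) (lambdaF / Real.pi ^ 2) := by
  have hπ := Real.pi_pos
  set j := sInf besselJ0Zeros with hj
  have hj0 : 0 < j := isLeast_besselJ0Zeros.1.1
  have hk : j / Real.pi * Real.pi = j := by field_simp
  have hk2 : lambdaF / Real.pi ^ 2 = (j / Real.pi) ^ 2 := by rw [lambdaF, div_pow]
  have hz : besselJ 0 (j / Real.pi * Real.pi) = 0 := by
    rw [hk]; exact isLeast_besselJ0Zeros.1.2
  rw [hk2]
  refine IsSharpStrictHardy.of_representatives (fun f hf => ?_) fun δ hδ K => ?_
  · obtain ⟨F, g, hfF, hP, h0, hg⟩ := exists_isL2Primitive_of_mem_sobolevH10 hπ hf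
    obtain ⟨h1, h2⟩ := hP.bessel_hardy hπ (besselJ_zero_mul_pos hπ hk hj0 le_rfl)
      (hP.tendsto_besselW_dirichlet hπ h0 (by positivity) hz
        (by rw [hk]; exact besselJ_one_pos_at_zero.ne'))
    exact ⟨F, g, hfF, hg, hP.integrableOn_norm_sq_div_sq hπ, h1,
      fun h => ae_eq_zero_of_forall_mem_Ioo (h2 h)⟩
  · obtain ⟨ε, hε, h1, h2⟩ := exists_besselTrial_complex hπ (by rw [hz, zero_mul]) hδ K
    have hP := isL2Primitive_besselTrial (j / Real.pi) hπ hε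
    refine ⟨_, hP.mem_sobolevH10 hπ ?_, _, hP.hasWeakDeriv hπ, h1, h2⟩
    rw [← besselTrial_right_eq_integral hπ hε, besselTrial_right_eq_zero hz, Complex.ofReal_zero]

theorem isSharpStrictHardy_distBoundary :
    IsSharpStrictHardy (sobolevH10 (Ioo 0 Real.pi)) distBoundary
      (1 / 4) (4 * lambdaDN / Real.pi ^ 2) := by
  have hπ := Real.pi_pos
  set b := Real.pi / 2 with hb_def
  have hb : 0 < b := by positivity
  have hc : Real.pi = 2 * b := by rw [hb_def]; ring
  set k := lambConstant / b with hk_def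
  have hk : k * b = lambConstant := by rw [hk_def]; field_simp
  have hk2 : 4 * lambdaDN / Real.pi ^ 2 = k ^ 2 := by
    rw [lambdaDN, hk_def, hc]; field_simp; ring
  rw [hk2]
  have hd1 : ∀ x ∈ Ioo 0 b, distBoundary x = x := fun x hx => if_pos hx.2.le
  have hd2 : ∀ x ∈ Ioo 0 b, distBoundary (Real.pi - x) = x := fun x hx => by
    rw [distBoundary, if_neg (by have := hx.2; rw [← hb_def]; linarith), sub_sub_cancel]
  have hN := neumann_of_mul_eq_lambConstant hk
  refine IsSharpStrictHardy.of_representatives (fun f hf => ?_) fun δ hδ K => ?_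
  · obtain ⟨F, g, hfF, hP, h0, hg⟩ := exists_isL2Primitive_of_mem_sobolevH10 hπ hf
    -- both halves of the interval are treated as intervals `(0, π/2)` with a free endpoint
    have hP1 := hP.mono (show b ≤ Real.pi by linarith)
    have hP2 := (hP.reflect hπ h0).mono (show b ≤ Real.pi by linarith)
    obtain ⟨l1, q1⟩ := hP1.lamb_hardy hb hk
    obtain ⟨l2, q2⟩ := hP2.lamb_hardy hb hk
    have hi : IntegrableOn (fun x => ‖F x‖ ^ 2 / distBoundary x ^ 2) (Ioo 0 Real.pi) := by
      rw [integrableOn_Ioo_iff_reflect hb hc]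
      exact ⟨(hP1.integrableOn_norm_sq_div_sq hb).congr_fun
          (fun x hx => by simp only [hd1 x hx]) measurableSet_Ioo,
        (hP2.integrableOn_norm_sq_div_sq hb).congr_fun
          (fun x hx => by simp only [hd2 x hx]) measurableSet_Ioo⟩
    have e1 : ∫ x in Ioo 0 Real.pi, ‖F x‖ ^ 2 / distBoundary x ^ 2 =
        (∫ x in Ioo 0 b, ‖F x‖ ^ 2 / x ^ 2) +
          ∫ x in Ioo 0 b, ‖F (Real.pi - x)‖ ^ 2 / x ^ 2 := by
      rw [integral_Ioo_eq_add_reflect hb hc hi]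
      congr 1
      · exact setIntegral_congr_fun measurableSet_Ioo fun x hx => by simp only [hd1 x hx]
      · exact setIntegral_congr_fun measurableSet_Ioo fun x hx => by simp only [hd2 x hx]
    have e2 := integral_Ioo_eq_add_reflect hb hc (hP.integrableOn_norm_sq hπ)
    have e3 := integral_Ioo_eq_add_reflect hb hc hP.integrableOn_sq
    simp only [norm_neg] at l2 q2
    refine ⟨F, g, hfF, hg, hi, ?_, fun heq => ?_⟩
    · rw [e1, e2, e3]
      linarith
    · rw [e1, e2, e3] at heq
      have z1 := q1 (by linarith)
      have z2 := q2 (by linarith)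
      have hne : ∀ᵐ x : ℝ, x ≠ b := by simp [ae_iff]
      filter_upwards [ae_restrict_mem measurableSet_Ioo, ae_restrict_of_ae hne] with x hx hxb
      rcases lt_or_gt_of_ne hxb with hlt | hgt
      · exact z1 x ⟨hx.1, hlt⟩
      · have := z2 (Real.pi - x) ⟨by linarith [hx.2], by linarith⟩
        simpa using this
  · obtain ⟨ε, hε, h1, h2⟩ := exists_besselTrial_complex hb (by rw [hN, mul_zero]) hδ K
    have hT := isL2Primitive_besselTrial k hb hε
    obtain ⟨hP, h0⟩ := hT.even_extension hb hc (besselTrial_right_eq_integral hb hε)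
    set F : ℝ → ℂ := fun x => if x ≤ b then (besselTrial k b ε x : ℂ) else
      (besselTrial k b ε (Real.pi - x) : ℂ) with hF
    set g : ℝ → ℂ := fun x => if x ≤ b then (besselTrialDeriv k b ε x : ℂ) else
      -(besselTrialDeriv k b ε (Real.pi - x) : ℂ) with hg
    refine ⟨F, hP.mem_sobolevH10 hπ h0, g, hP.hasWeakDeriv hπ, ?_⟩
    have hF1 : ∀ x ∈ Ioo 0 b, F x = besselTrial k b ε x := fun x hx => if_pos hx.2.le
    have hF2 : ∀ x ∈ Ioo 0 b, F (Real.pi - x) = besselTrial k b ε x := fun x hx => by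
      simp only [hF]
      rw [if_neg (by linarith [hx.2]), sub_sub_cancel]
    have hg1 : ∀ x ∈ Ioo 0 b, g x = besselTrialDeriv k b ε x := fun x hx => if_pos hx.2.le
    have hg2 : ∀ x ∈ Ioo 0 b, g (Real.pi - x) = -besselTrialDeriv k b ε x := fun x hx => by
      simp only [hg]
      rw [if_neg (by linarith [hx.2]), sub_sub_cancel]
    have hi : IntegrableOn (fun x => ‖F x‖ ^ 2 / distBoundary x ^ 2) (Ioo 0 Real.pi) := by
      rw [integrableOn_Ioo_iff_reflect hb hc]
      have := hT.integrableOn_norm_sq_div_sq hb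
      exact ⟨this.congr_fun (fun x hx => by simp only [hd1 x hx, hF1 x hx]) measurableSet_Ioo,
        this.congr_fun (fun x hx => by simp only [hd2 x hx, hF2 x hx]) measurableSet_Ioo⟩
    have e1 : ∫ x in Ioo 0 Real.pi, ‖F x‖ ^ 2 / distBoundary x ^ 2 =
        2 * ∫ x in Ioo 0 b, ‖(besselTrial k b ε x : ℂ)‖ ^ 2 / x ^ 2 := by
      rw [integral_Ioo_eq_add_reflect hb hc hi, two_mul]
      congr 1
      · exact setIntegral_congr_fun measurableSet_Ioo fun x hx => by
          simp only [hd1 x hx, hF1 x hx]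
      · exact setIntegral_congr_fun measurableSet_Ioo fun x hx => by
          simp only [hd2 x hx, hF2 x hx]
    have e2 : ∫ x in Ioo 0 Real.pi, ‖F x‖ ^ 2 =
        2 * ∫ x in Ioo 0 b, ‖(besselTrial k b ε x : ℂ)‖ ^ 2 := by
      rw [integral_Ioo_eq_add_reflect hb hc (hP.integrableOn_norm_sq hπ), two_mul]
      congr 1
      · exact setIntegral_congr_fun measurableSet_Ioo fun x hx => by simp only [hF1 x hx]
      · exact setIntegral_congr_fun measurableSet_Ioo fun x hx => by simp only [hF2 x hx]
    have e3 : ∫ x in Ioo 0 Real.pi, ‖g x‖ ^ 2 =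
        2 * ∫ x in Ioo 0 b, ‖(besselTrialDeriv k b ε x : ℂ)‖ ^ 2 := by
      rw [integral_Ioo_eq_add_reflect hb hc hP.integrableOn_sq, two_mul]
      congr 1
      · exact setIntegral_congr_fun measurableSet_Ioo fun x hx => by simp only [hg1 x hx]
      · exact setIntegral_congr_fun measurableSet_Ioo fun x hx => by
          simp only [hg2 x hx, norm_neg]
    rw [e1, e2, e3]
    constructor <;> linarith

theorem mainTheorem2 :
    IsLeast lambZeros lambConstant ∧
    IsLeast besselJ0Zeros (sInf besselJ0Zeros) ∧
    IsSharpStrictHardy (formDomainDN ∩ sobolevH1 (Ioo 0 Real.pi)) (fun x => x)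
      (1 / 4) (lambdaDN / Real.pi ^ 2) ∧
    IsSharpStrictHardy (sobolevH10 (Ioo 0 Real.pi)) (fun x => x)
      (1 / 4) (lambdaF / Real.pi ^ 2) ∧
    IsSharpStrictHardy (sobolevH10 (Ioo 0 Real.pi)) distBoundary
      (1 / 4) (4 * lambdaDN / Real.pi ^ 2) :=
  ⟨isLeast_lambZeros, isLeast_besselJ0Zeros, isSharpStrictHardy_formDomainDN,
    isSharpStrictHardy_sobolevH10, isSharpStrictHardy_distBoundary⟩
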